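/- Let $(X,d)$ be a complete separable metric space with a Borel measure $\mu$ such that $0<\mu(B(x,r))<\infty$ for every open ball $B(x,r)=\{y: d(x,y)<r\}$, $r>0$, and let $1\le p<\infty$. A Borel function $g:X\to[0,\infty]$ is an upper gradient of $f:X\to[-\infty,\infty]$ if $|f(\gamma(1))-f(\gamma(0))|\le\int_\gamma g\,ds$ for every non-constant rectifiable curve $\gamma:[0,1]\to X$, where $|\infty-\infty|=|(-\infty)-(-\infty)|=\infty$; it is a $p$-weak upper gradient if this holds for all such curves outside a family of rectifiable curves of zero $p$-modulus. $N^{1,p}(X)$ is the set of functions $f:X\to[-\infty,\infty]$ in $L^p(X)$ (defined everywhere) that have an upper gradient in $L^p(X)$. A minimal $p$-weak upper gradient $g_f$ of $f$ is a $p$-weak upper gradient in $L^p(X)$ with $g_f\le h$ $\mu$-a.e. for every $p$-weak upper gradient $h\in L^p(X)$ of $f$; it is unique up to $\mu$-null sets. Let $f\in N^{1,p}(X)$ and let $g_*\in L^p(X)$ be an upper gradient of $f$. Suppose that $f=0$ on $X\setminus B(x_0,R)$ for some $x_0\in X$ and $R>0$, and let $K\subset B(x_0,R)$ be compact such that $f|_K$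 is real-valued and continuous and $g_*|_K$ is bounded. Then for every $\epsilon>0$ there is a function $\tilde f:X\to\mathbb R$ such that 1. $\sup_{x\in X}|\tilde f(x)|\le\sup_{x\in K}|f(x)|$ (with $\sup_\emptyset=0$); 2. $\tilde f|_K=f|_K$ and $\tilde f=0$ on $X\setminus B(x_0,R)$; 3. $\tilde f\in N^{1,p}(X)$ and $\tilde f$ is continuous on $X$; 4. $\tilde f$ has a minimal $p$-weak upper gradient $g_{\tilde f}$, and $\int_{X\setminus K}g_{\tilde f}^p\,d\mu\le\int_{X\setminus K}g_*^p\,d\mu+\epsilon$. -/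

import Mathlib

open Set MeasureTheory Metric
open scoped ENNReal unitInterval

noncomputable section

namespace Newtonian

variable {X : Type*} [MetricSpace X]

/-- The length of a curve `γ : [0,1] → X`. -/
def curveLength (γ : C(I, X)) : ℝ≥0∞ := eVariationOn γ univ

/-- A curve is rectifiable if it has finite length. -/
def Rectifiable (γ : C(I, X)) : Prop := curveLength γ < ∞

/-- The curve `γ` is not constant. -/
def Nonconstant (γ : C(I, X)) : Prop := ∃ s t : I, γ s ≠ γ t

/-- The constant-speed parametrization on `[0,1]` of a rectifiable curve: Mathlib's arc-length
parametrization (on `[0, Len γ]`), rescaled linearly to `[0,1]`. -/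
def constantSpeed (γ : C(I, X)) (t : ℝ) : X :=
  naturalParameterization γ univ 0 ((curveLength γ).toReal * t)

/-- The path integral `∫_γ g ds = Len(γ) ∫₀¹ g(γ̃(t)) dt` of `g : X → [0,∞]` along a rectifiable
curve `γ` with constant-speed parametrization `γ̃`. -/
def pathIntegral (γ : C(I, X)) (g : X → ℝ≥0∞) : ℝ≥0∞ :=
  curveLength γ * ∫⁻ t in Icc (0 : ℝ) 1, g (constantSpeed γ t)

/-- `|a - b|` for extended reals `a`, `b`, with the convention `|∞ - ∞| = |(-∞) - (-∞)| = ∞`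
(see `gap_top_top` and `gap_bot_bot`). -/
def gap (a b : EReal) : ℝ≥0∞ := (a - b).abs

theorem gap_coe (a b : ℝ) : gap a b = ENNReal.ofReal |a - b| := by
  rw [gap, ← EReal.coe_sub, EReal.abs_def]

theorem gap_top_top : gap ⊤ ⊤ = ∞ := by simp [gap]

theorem gap_bot_bot : gap ⊥ ⊥ = ∞ := by simp [gap]

/-- The upper gradient inequality `|f(γ(1)) - f(γ(0))| ≤ ∫_γ g ds` on the curve `γ`. -/
def UpperGradientInequality (g : X → ℝ≥0∞) (f : X → EReal) (γ : C(I, X)) : Prop :=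
  gap (f (γ 1)) (f (γ 0)) ≤ pathIntegral γ g

variable [MeasurableSpace X]

/-- `g` is an upper gradient of `f`: it is Borel, and the upper gradient inequality holds on every
rectifiable curve. Constant curves are left out: they say nothing about finite values of `f`, and
with the convention `|∞ - ∞| = ∞` they would only forbid infinite values. -/
def IsUpperGradient (g : X → ℝ≥0∞) (f : X → EReal) : Prop :=
  Measurable g ∧
    ∀ γ : C(I, X), Rectifiable γ → Nonconstant γ → UpperGradientInequality g f γ

/-- The Borel function `ρ : X → [0,∞]` is admissible for the family `Γ` of rectifiable curves. -/
def Admissible (Γ : Set C(I, X)) (ρ : X → ℝ≥0∞) : Prop :=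
  Measurable ρ ∧ ∀ γ ∈ Γ, 1 ≤ pathIntegral γ ρ

/-- The `p`-modulus of a family of rectifiable curves. -/
def modulus (p : ℝ) (μ : Measure X) (Γ : Set C(I, X)) : ℝ≥0∞ :=
  ⨅ (ρ : X → ℝ≥0∞) (_ : Admissible Γ ρ), ∫⁻ x, ρ x ^ p ∂μ

/-- A property holds for `p`-a.e. curve: it holds for all rectifiable curves outside a family of
rectifiable curves of zero `p`-modulus. -/
def ForAECurve (p : ℝ) (μ : Measure X) (P : C(I, X) → Prop) : Prop :=
  ∃ Γ : Set C(I, X), (∀ γ ∈ Γ, Rectifiable γ) ∧ modulus p μ Γ = 0 ∧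
    ∀ γ : C(I, X), Rectifiable γ → γ ∉ Γ → P γ

/-- `g` is a `p`-weak upper gradient of `f`. -/
def IsWeakUpperGradient (p : ℝ) (μ : Measure X) (g : X → ℝ≥0∞) (f : X → EReal) : Prop :=
  Measurable g ∧
    ForAECurve p μ (fun γ => Nonconstant γ → UpperGradientInequality g f γ)

/-- The extended-real-valued function `f` belongs to `L^p(X)`. -/
def InLp (p : ℝ) (μ : Measure X) (f : X → EReal) : Prop :=
  AEMeasurable f μ ∧ ∫⁻ x, (f x).abs ^ p ∂μ < ∞

/-- The Newtonian space `N^{1,p}(X)` (of everywhere defined functions): the functions in `L^p(X)`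
that have an upper gradient in `L^p(X)`. -/
def InNewtonian (p : ℝ) (μ : Measure X) (f : X → EReal) : Prop :=
  InLp p μ f ∧ ∃ g : X → ℝ≥0∞, IsUpperGradient g f ∧ ∫⁻ x, g x ^ p ∂μ < ∞

/-- `g` is a minimal `p`-weak upper gradient of `f`: a `p`-weak upper gradient in `L^p(X)` that is
a.e. at most any other one in `L^p(X)`. By definition any two of them agree a.e. -/
def IsMinimalWeakUpperGradient (p : ℝ) (μ : Measure X) (g : X → ℝ≥0∞) (f : X → EReal) : Prop :=
  IsWeakUpperGradient p μ g f ∧ ∫⁻ x, g x ^ p ∂μ < ∞ ∧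
    ∀ h : X → ℝ≥0∞, IsWeakUpperGradient p μ h f → ∫⁻ x, h x ^ p ∂μ < ∞ → g ≤ᵐ[μ] h

end Newtonian

end

/-! After truncation at height `M = sup_K |f|`, the function `f` is bounded and still has `gstar` as
an upper gradient along nonconstant curves. By Vitali–Carathéodory on the finite measure `μ.restrict
B`, replace `gstar` by a lower semicontinuous `W ≥ gstar` that costs at most `ε` more energy on `B`.
It can also be made at least some `η > 0` everywhere and at least `N` off a compact set `T N ⊇ K`
(`exists_lowerSemicontinuous_weight`).

Put `A = K ∪ Bᶜ`, a closed set on which `f` is continuous. Let `w_n ≤ W` be Lipschitz approximations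
of `W`. Define `u_n(x)` as the minimum of `M` and the infimum of `f(q 0) + ∑ w_n(q i) d(q i, q
(i+1))` over discrete paths from `A` to `x` with steps at most `1/(n+1)`. Discrete paths make `u_n`
automatically continuous: at scale `1/(n+1)` its slope is at most `w_n`, so `W` is an upper gradient
of `u_n`. Also `u_n ≤ f` on `A`.

The heart is that for each `δ > 0` some `u_n` is at least `f - δ` on all of `A`
(`exists_forall_sub_le_chainExtension`). Otherwise there are cheap discrete paths between points of
`A`, with cost below the increment of `f` minus `δ`. Such a path must have an end in `K`, as `f`
vanishes on the rest of `A`. Largeness of `W` off compact sets confines the paths to one compact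
set, and `W ≥ η` bounds their lengths. A subsequence converges to a rectifiable curve, and by Fatou
and lower semicontinuity the integral of `W` along it is at most the increment of `f` minus `δ`.
This contradicts the upper gradient inequality.

Successive clamping turns these uniform approximations on `A` into one continuous `F` that equals
the truncated `f` on `A`, with no loss in the upper gradient `W`
(`exists_continuous_eqOn_of_uniform_approx`). As `F` vanishes off `B`, the upper gradient may be cut
down to `B.indicator W`. A minimal weak upper gradient exists because weak upper gradients in `L^p`
are closed under countable infima. It is at most `B.indicator W` almost everywhere, and discarding
the integrals over `K`, where `gstar ≤ W`, gives the energy bound. -/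

noncomputable section
open Filter Topology
open scoped NNReal

namespace Newtonian

/-! ### Arc length, constant-speed parametrization, subcurves and path integrals. -/

section Curves

variable {X : Type*} [MetricSpace X]

/-- The arc length of `γ` on `[0, t]`. -/
def arcLength (γ : C(I, X)) (t : I) : ℝ := variationOnFromTo γ univ 0 t

theorem Rectifiable.boundedVariationOn {γ : C(I, X)} (h : Rectifiable γ) :
    BoundedVariationOn γ univ := ne_of_lt h

theorem Rectifiable.locallyBoundedVariationOn {γ : C(I, X)} (h : Rectifiable γ) :
    LocallyBoundedVariationOn γ univ := h.boundedVariationOn.locallyBoundedVariationOn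

theorem arcLength_zero (γ : C(I, X)) : arcLength γ 0 = 0 := variationOnFromTo.self _ _ _

theorem arcLength_one (γ : C(I, X)) : arcLength γ 1 = (curveLength γ).toReal := by
  have h : (Icc 0 1 : Set I) = univ := eq_univ_of_forall fun x => ⟨x.2.1, x.2.2⟩
  rw [arcLength, variationOnFromTo.eq_of_le _ _ zero_le_one, univ_inter, h, curveLength]

theorem arcLength_sub {γ : C(I, X)} (h : Rectifiable γ) (s t : I) :
    arcLength γ t - arcLength γ s = variationOnFromTo γ univ s t :=
  variationOnFromTo.sub_right h.locallyBoundedVariationOn (mem_univ _) (mem_univ _) (mem_univ _)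

theorem monotone_arcLength {γ : C(I, X)} (h : Rectifiable γ) : Monotone (arcLength γ) :=
  monotoneOn_univ.1 (variationOnFromTo.monotoneOn h.locallyBoundedVariationOn (mem_univ _))

theorem abs_arcLength_sub {γ : C(I, X)} (h : Rectifiable γ) {s t : I} (hst : s ≤ t) :
    |arcLength γ t - arcLength γ s| = (eVariationOn γ (Icc s t)).toReal := by
  rw [arcLength_sub h, variationOnFromTo.eq_of_le _ _ hst, univ_inter, abs_of_nonneg (by positivity)]

theorem continuous_arcLength {γ : C(I, X)} (h : Rectifiable γ) : Continuous (arcLength γ) := by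
  rw [continuous_iff_continuousAt]
  intro x
  rw [ContinuousAt, tendsto_iff_dist_tendsto_zero]
  have h1 := h.boundedVariationOn.tendsto_eVariationOn_Icc_zero_left (x := x)
    γ.continuous.continuousWithinAt
  have h2 := h.boundedVariationOn.tendsto_eVariationOn_Icc_zero_right x
    γ.continuous.continuousWithinAt
  simp only [univ_inter, nhdsWithin_univ] at h1 h2
  have h3 := (ENNReal.tendsto_toReal (by simp)).comp h1
  have h4 := (ENNReal.tendsto_toReal (by simp)).comp h2
  have h5 := h3.add h4
  simp only [ENNReal.toReal_zero, add_zero] at h5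
  refine squeeze_zero (fun _ => dist_nonneg) (fun y => ?_) h5
  rw [Real.dist_eq]
  rcases le_total x y with hxy | hxy
  · rw [abs_arcLength_sub h hxy]
    simp
  · rw [abs_sub_comm, abs_arcLength_sub h hxy]
    simp

theorem dist_le_abs_arcLength_sub {γ : C(I, X)} (h : Rectifiable γ) (s t : I) :
    dist (γ s) (γ t) ≤ |arcLength γ s - arcLength γ t| := by
  wlog hst : s ≤ t
  · rw [dist_comm, abs_sub_comm]
    exact this h t s (le_of_not_ge hst)
  rw [abs_sub_comm, abs_arcLength_sub h hst]
  exact (h.boundedVariationOn.mono (subset_univ _)).dist_le ⟨le_rfl, hst⟩ ⟨hst, le_rfl⟩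

theorem constantSpeed_of_arcLength_eq {γ : C(I, X)} (h : Rectifiable γ) {b : I} {t : ℝ}
    (hb : arcLength γ b = (curveLength γ).toReal * t) : constantSpeed γ t = γ b := by
  rw [constantSpeed, ← hb]
  exact edist_eq_zero.1 (edist_naturalParameterization_eq_zero h.locallyBoundedVariationOn
    (mem_univ 0) (mem_univ b))

theorem exists_arcLength_eq {γ : C(I, X)} (h : Rectifiable γ) {s : ℝ}
    (hs : s ∈ Icc 0 (curveLength γ).toReal) : ∃ b : I, arcLength γ b = s := by
  have := intermediate_value_univ (0 : I) 1 (continuous_arcLength h)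
  rw [arcLength_zero, arcLength_one] at this
  exact this hs

theorem exists_arcLength_eq_mul {γ : C(I, X)} (h : Rectifiable γ) {t : ℝ} (ht : t ∈ Icc (0 : ℝ) 1) :
    ∃ b : I, arcLength γ b = (curveLength γ).toReal * t :=
  exists_arcLength_eq h ⟨mul_nonneg (by positivity) ht.1,
    mul_le_of_le_one_right (by positivity) ht.2⟩

/-- The constant-speed parametrization, extended from `[0,1]` to the real line by constants. -/
def param (γ : C(I, X)) (t : ℝ) : X := constantSpeed γ (projIcc (0 : ℝ) 1 zero_le_one t)

theorem param_of_mem (γ : C(I, X)) {t : ℝ} (ht : t ∈ Icc (0 : ℝ) 1) :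
    param γ t = constantSpeed γ t := by
  rw [param, projIcc_of_mem _ ht]

theorem lipschitzWith_param {γ : C(I, X)} (h : Rectifiable γ) :
    LipschitzWith (curveLength γ).toNNReal (param γ) := by
  refine LipschitzWith.of_dist_le_mul fun s t => ?_
  obtain ⟨b, hb⟩ := exists_arcLength_eq_mul h (projIcc (0 : ℝ) 1 zero_le_one s).2
  obtain ⟨c, hc⟩ := exists_arcLength_eq_mul h (projIcc (0 : ℝ) 1 zero_le_one t).2
  rw [param, param, constantSpeed_of_arcLength_eq h hb, constantSpeed_of_arcLength_eq h hc]
  refine (dist_le_abs_arcLength_sub h b c).trans ?_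
  rw [hb, hc, ← mul_sub, abs_mul, abs_of_nonneg (by positivity : 0 ≤ (curveLength γ).toReal)]
  refine mul_le_mul_of_nonneg_left ?_ (by positivity)
  exact abs_projIcc_sub_projIcc zero_le_one

theorem param_zero {γ : C(I, X)} (h : Rectifiable γ) : param γ 0 = γ 0 := by
  rw [param_of_mem _ (by simp), constantSpeed_of_arcLength_eq h (b := 0)]
  simp [arcLength_zero]

theorem param_one {γ : C(I, X)} (h : Rectifiable γ) : param γ 1 = γ 1 := by
  rw [param_of_mem _ (by simp), constantSpeed_of_arcLength_eq h (b := 1)]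
  simp [arcLength_one]

theorem pathIntegral_eq_param (γ : C(I, X)) (g : X → ℝ≥0∞) :
    pathIntegral γ g = curveLength γ * ∫⁻ t in Icc (0 : ℝ) 1, g (param γ t) := by
  rw [pathIntegral]
  congr 1
  refine setLIntegral_congr_fun measurableSet_Icc fun t ht => ?_
  rw [param_of_mem _ ht]

theorem eVariationOn_param {γ : C(I, X)} (h : Rectifiable γ) {a b : ℝ} (ha : 0 ≤ a) (hab : a ≤ b)
    (hb : b ≤ 1) :
    eVariationOn (param γ) (Icc a b) = ENNReal.ofReal ((curveLength γ).toReal * (b - a)) := by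
  set L := (curveLength γ).toReal with hL
  have hL0 : 0 ≤ L := by positivity
  have h1 : EqOn (param γ) (naturalParameterization γ univ 0 ∘ fun t => L * t) (Icc a b) :=
    fun t ht => param_of_mem _ ⟨ha.trans ht.1, ht.2.trans hb⟩
  have hmono : Monotone fun t : ℝ => L * t := monotone_mul_left_of_nonneg hL0
  rw [eVariationOn.congr h1, eVariationOn.comp_eq_of_monotoneOn _ _ (hmono.monotoneOn _)]
  have h2 : (fun t => L * t) '' Icc a b = Icc (L * a) (L * b) := by
    rcases hL0.eq_or_lt with h0 | h0
    · simp [← h0, nonempty_Icc.2 hab]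
    · exact Set.image_mul_left_Icc' h0 a b
  have hu := has_unit_speed_naturalParameterization γ h.locallyBoundedVariationOn (mem_univ 0)
  have hmem : ∀ t ∈ Icc (0 : ℝ) 1, L * t ∈ variationOnFromTo γ univ 0 '' univ := fun t ht => by
    obtain ⟨c, hc⟩ := exists_arcLength_eq_mul h ht
    exact ⟨c, mem_univ _, hc⟩
  have h3 := hu (hmem a ⟨ha, hab.trans hb⟩) (hmem b ⟨ha.trans hab, hb⟩)
  rw [inter_eq_self_of_subset_right] at h3
  · rw [h2, h3]
    simp [mul_sub]
  · rw [← h2]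
    rintro _ ⟨t, ht, rfl⟩
    exact hmem t ⟨ha.trans ht.1, ht.2.trans hb⟩

/-- A curve that already has constant speed is its own constant-speed parametrization. -/
theorem constantSpeed_eq_self {τ : C(I, X)} {l : ℝ} (hl : 0 ≤ l)
    (hτ : ∀ u : I, eVariationOn τ (Icc 0 u) = ENNReal.ofReal (l * u)) :
    curveLength τ = ENNReal.ofReal l ∧ ∀ u : I, constantSpeed τ u = τ u := by
  have h : (Icc 0 1 : Set I) = univ := eq_univ_of_forall fun x => ⟨x.2.1, x.2.2⟩
  have h1 : curveLength τ = ENNReal.ofReal l := by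
    have := hτ 1
    rw [h] at this
    simpa [curveLength] using this
  refine ⟨h1, fun u => constantSpeed_of_arcLength_eq (by simp [Rectifiable, h1]) ?_⟩
  have hu : (0 : I) ≤ u := u.2.1
  rw [arcLength, variationOnFromTo.eq_of_le _ _ hu, univ_inter, hτ, h1,
    ENNReal.toReal_ofReal hl, ENNReal.toReal_ofReal (mul_nonneg hl u.2.1)]

/-- The subcurve of a rectifiable curve between two parameters of its constant-speed
parametrization. -/
theorem exists_subcurve {γ : C(I, X)} (h : Rectifiable γ) {a b : ℝ} (ha : 0 ≤ a) (hab : a < b)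
    (hb : b ≤ 1) :
    ∃ τ : C(I, X), Rectifiable τ ∧ τ 0 = param γ a ∧ τ 1 = param γ b ∧
      ∀ g : X → ℝ≥0∞, pathIntegral τ g = curveLength γ * ∫⁻ t in Icc a b, g (param γ t) := by
  set L := (curveLength γ).toReal with hL
  have hL0 : 0 ≤ L := by positivity
  have hba : 0 < b - a := sub_pos.2 hab
  let φ : ℝ → ℝ := fun u => (b - a) * u + a
  have hφ : Monotone φ := fun u v huv => by
    simp only [φ]; gcongr
  let τ : C(I, X) := ⟨fun u => param γ (φ u), by
    have := (lipschitzWith_param h).continuous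
    fun_prop⟩
  have hspeed : ∀ u : I, eVariationOn τ (Icc 0 u) = ENNReal.ofReal (L * (b - a) * u) := by
    intro u
    have e1 : (τ : I → X) = param γ ∘ (fun u : I => φ u) := rfl
    have e2 : (fun u : I => φ u) '' Icc 0 u = Icc a (φ u) := by
      ext t
      constructor
      · rintro ⟨v, hv, rfl⟩
        refine ⟨?_, hφ hv.2⟩
        have : 0 ≤ (v : ℝ) := v.2.1
        simp only [φ]
        nlinarith
      · rintro ⟨h1, h2⟩
        have h3 : (t - a) / (b - a) ≤ u := by
          rw [div_le_iff₀ hba]; simp only [φ] at h2; linarith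
        have h4 : 0 ≤ (t - a) / (b - a) := div_nonneg (by linarith) hba.le
        refine ⟨⟨(t - a) / (b - a), h4, h3.trans u.2.2⟩, ⟨h4, h3⟩, ?_⟩
        simp only [φ]
        field_simp
        ring
    have hu0 : 0 ≤ (u : ℝ) := u.2.1
    have hu1 : (u : ℝ) ≤ 1 := u.2.2
    rw [e1, eVariationOn.comp_eq_of_monotoneOn _ (fun u : I => φ u)
      (fun x _ y _ hxy => hφ hxy), e2,
      eVariationOn_param h ha (by simp only [φ]; nlinarith) (by simp only [φ]; nlinarith)]
    simp only [φ]
    congr 1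
    ring
  obtain ⟨hlen, hcs⟩ := constantSpeed_eq_self (by positivity) hspeed
  refine ⟨τ, by simp [Rectifiable, hlen], ?_, ?_, fun g => ?_⟩
  · simp [τ, φ]
  · simp [τ, φ]
  · have e1 : φ '' Icc 0 1 = Icc a b := by
      simp only [φ]
      have := Set.image_affine_Icc' hba a 0 1
      simpa using this
    rw [← e1, lintegral_image_eq_lintegral_abs_deriv_mul measurableSet_Icc (f' := fun _ => b - a)
      (fun x _ => ?_) (fun x _ y _ hxy => ?_)]
    · rw [lintegral_const_mul' _ _ (by simp), pathIntegral, hlen, ← mul_assoc, abs_of_pos hba]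
      congr 1
      · rw [ENNReal.ofReal_mul hL0, hL, ENNReal.ofReal_toReal (ne_of_lt h)]
      · refine setLIntegral_congr_fun measurableSet_Icc fun t ht => ?_
        have := hcs ⟨t, ht⟩
        simp only at this
        rw [this]
        rfl
    · simpa [φ] using (((hasDerivAt_id x).const_mul (b - a)).add_const a).hasDerivWithinAt
    · simp only [φ] at hxy
      have := hba.ne'
      simpa [this] using hxy

/-- A `k`-Lipschitz map increases one-dimensional Hausdorff measure by a factor of at most `k`.
Since `θ` covers `[0,1]`, Lebesgue measure there is at most `k` times its push-forward under `θ`;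
injectivity of `θ` plays no role. -/
theorem setLIntegral_le_mul_comp_of_lipschitzOnWith {θ : ℝ → ℝ} {k : ℝ≥0} (hθ : Continuous θ)
    (hk : LipschitzOnWith k θ (Icc 0 1)) (hsurj : Icc 0 1 ⊆ θ '' Icc 0 1) {h : ℝ → ℝ≥0∞}
    (hh : Measurable h) :
    ∫⁻ s in Icc (0 : ℝ) 1, h s ≤ k * ∫⁻ t in Icc (0 : ℝ) 1, h (θ t) := by
  have hle : volume.restrict (Icc (0 : ℝ) 1) ≤
      (k : ℝ≥0∞) • (volume.restrict (Icc (0 : ℝ) 1)).map θ := by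
    refine Measure.le_iff.2 fun E hE => ?_
    rw [Measure.restrict_apply hE, Measure.smul_apply, Measure.map_apply hθ.measurable hE,
      Measure.restrict_apply (hθ.measurable hE), smul_eq_mul]
    have h1 : E ∩ Icc 0 1 ⊆ θ '' (θ ⁻¹' E ∩ Icc 0 1) := by
      rintro s ⟨hsE, hs⟩
      obtain ⟨t, ht, rfl⟩ := hsurj hs
      exact ⟨t, ⟨hsE, ht⟩, rfl⟩
    refine (measure_mono h1).trans ?_
    have h2 := (hk.mono (inter_subset_right (s := θ ⁻¹' E))).hausdorffMeasure_image_le zero_le_one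
    simpa [hausdorffMeasure_real] using h2
  calc ∫⁻ s in Icc (0 : ℝ) 1, h s
      ≤ ∫⁻ s, h s ∂((k : ℝ≥0∞) • (volume.restrict (Icc (0 : ℝ) 1)).map θ) :=
        lintegral_mono' hle le_rfl
    _ = k * ∫⁻ t in Icc (0 : ℝ) 1, h (θ t) := by
        rw [lintegral_smul_measure, lintegral_map hh hθ.measurable, smul_eq_mul]

/-- The path integral is at most the Lipschitz constant times the integral of the composition. -/
theorem pathIntegral_le_of_lipschitzWith [MeasurableSpace X] [BorelSpace X] {γ : C(I, X)} {k : ℝ≥0}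
    (hγ : LipschitzWith k γ) {g : X → ℝ≥0∞} (hg : Measurable g) :
    Rectifiable γ ∧
      pathIntegral γ g ≤ k * ∫⁻ t in Icc (0 : ℝ) 1, g (γ (projIcc 0 1 zero_le_one t)) := by
  have hvar : ∀ s t : I, s ≤ t → eVariationOn γ (Icc s t) ≤ k * ENNReal.ofReal (t - s) := by
    intro s t hst
    have h1 := (hγ.lipschitzOnWith (s := univ)).comp_eVariationOn_le (f := γ) (g := id)
      (s := Icc s t) (fun _ _ => mem_univ _)
    refine h1.trans ?_
    gcongr
    have h2 : eVariationOn (id : I → I) (Icc s t) = eVariationOn (fun x : I => (x : ℝ)) (Icc s t) :=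
      rfl
    rw [h2]
    have h3 : MonotoneOn (fun x : I => (x : ℝ)) (Icc s t) := fun x _ y _ hxy => hxy
    simpa using (h3.eVariationOn_eq ⟨le_rfl, hst⟩ ⟨hst, le_rfl⟩).le
  have h01 : (Icc 0 1 : Set I) = univ := eq_univ_of_forall fun x => ⟨x.2.1, x.2.2⟩
  have hrect : Rectifiable γ := by
    have := hvar 0 1 zero_le_one
    rw [h01] at this
    exact this.trans_lt (ENNReal.mul_lt_top (by simp) (by simp))
  refine ⟨hrect, ?_⟩
  rw [pathIntegral_eq_param]
  set L := (curveLength γ).toReal with hL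
  have hLe : curveLength γ = ENNReal.ofReal L := (ENNReal.ofReal_toReal (ne_of_lt hrect)).symm
  rcases (by positivity : 0 ≤ L).eq_or_lt with h0 | h0
  · rw [hLe, ← h0]; simp
  -- `θ` is the normalized arc length, so `γ` is its constant-speed parametrization composed with
  -- `θ`. The Lipschitz constant `k / L` of `θ` cancels the factor `L` in the path integral.
  let θ : ℝ → ℝ := fun t => arcLength γ (projIcc 0 1 zero_le_one t) / L
  have hθc : Continuous θ :=
    ((continuous_arcLength hrect).comp continuous_projIcc).div_const L
  have harc : ∀ s t : I, |arcLength γ s - arcLength γ t| ≤ k * |(s : ℝ) - t| := by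
    intro s t
    wlog hst : t ≤ s generalizing s t
    · rw [abs_sub_comm, abs_sub_comm (s : ℝ)]
      exact this t s (le_of_not_ge hst)
    have hst' : (0 : ℝ) ≤ s - t := sub_nonneg.2 hst
    rw [abs_arcLength_sub hrect hst]
    refine ENNReal.toReal_le_of_le_ofReal (by positivity) ((hvar t s hst).trans (le_of_eq ?_))
    rw [ENNReal.ofReal_mul (by positivity), ENNReal.ofReal_coe_nnreal, abs_of_nonneg hst']
  have hθl : LipschitzOnWith (k / L.toNNReal) θ (Icc 0 1) := by
    refine LipschitzOnWith.of_dist_le_mul fun s hs t ht => ?_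
    simp only [θ, Real.dist_eq, ← sub_div, abs_div, abs_of_pos h0, projIcc_of_mem _ hs,
      projIcc_of_mem _ ht]
    have := harc ⟨s, hs⟩ ⟨t, ht⟩
    simp only at this
    rw [NNReal.coe_div, Real.coe_toNNReal _ h0.le, div_mul_eq_mul_div]
    gcongr
  have hparam : ∀ t ∈ Icc (0 : ℝ) 1, param γ (θ t) = γ (projIcc 0 1 zero_le_one t) := by
    intro t ht
    have hmem : θ t ∈ Icc (0 : ℝ) 1 := by
      have h1 := monotone_arcLength hrect (show 0 ≤ projIcc (0 : ℝ) 1 zero_le_one t from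
        (projIcc (0 : ℝ) 1 zero_le_one t).2.1)
      have h2 := monotone_arcLength hrect (show projIcc (0 : ℝ) 1 zero_le_one t ≤ 1 from
        (projIcc (0 : ℝ) 1 zero_le_one t).2.2)
      rw [arcLength_zero] at h1
      rw [arcLength_one] at h2
      exact ⟨div_nonneg h1 h0.le, (div_le_one h0).2 h2⟩
    rw [param_of_mem _ hmem]
    refine constantSpeed_of_arcLength_eq hrect ?_
    rw [← hL, mul_div_cancel₀ _ h0.ne']
  have hsurj : Icc 0 1 ⊆ θ '' Icc 0 1 := by
    intro s hs
    obtain ⟨b, hb⟩ := exists_arcLength_eq_mul hrect hs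
    refine ⟨b, b.2, ?_⟩
    simp only [θ, projIcc_val, hb]
    rw [← hL, mul_div_cancel_left₀ _ h0.ne']
  have hmeas : Measurable fun t => g (param γ t) :=
    hg.comp (lipschitzWith_param hrect).continuous.measurable
  calc curveLength γ * ∫⁻ t in Icc (0 : ℝ) 1, g (param γ t)
      ≤ curveLength γ * ((k / L.toNNReal : ℝ≥0) * ∫⁻ t in Icc (0 : ℝ) 1, g (param γ (θ t))) := by
        gcongr
        exact setLIntegral_le_mul_comp_of_lipschitzOnWith hθc hθl hsurj hmeas
    _ = k * ∫⁻ t in Icc (0 : ℝ) 1, g (γ (projIcc 0 1 zero_le_one t)) := by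
        rw [← mul_assoc]
        congr 1
        · rw [hLe, ENNReal.ofReal, ← ENNReal.coe_mul, mul_div_cancel₀]
          simpa using h0
        · refine setLIntegral_congr_fun measurableSet_Icc fun t ht => ?_
          simp only [hparam t ht]

end Curves

/-! ### Increments on an interval dominated by several integrals at once. -/

section Real

theorem abs_deriv_le_of_abs_sub_le {φ G : ℝ → ℝ} {t φ' G' : ℝ} (hφ : HasDerivAt φ φ' t)
    (hG : HasDerivAt G G' t) (h : ∀ᶠ s in 𝓝 t, |φ s - φ t| ≤ |G s - G t|) : |φ'| ≤ |G'| := by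
  have h1 := (hasDerivAt_iff_tendsto_slope.1 hφ).abs
  have h2 := (hasDerivAt_iff_tendsto_slope.1 hG).abs
  refine le_of_tendsto_of_tendsto h1 h2 ?_
  filter_upwards [h.filter_mono nhdsWithin_le_nhds] with s hs
  simp only [slope_def_field, abs_div]
  gcongr

theorem absolutelyContinuousOnInterval_of_dist_le {φ G : ℝ → ℝ} {a b : ℝ}
    (hG : AbsolutelyContinuousOnInterval G a b)
    (h : ∀ s ∈ uIcc a b, ∀ t ∈ uIcc a b, dist (φ s) (φ t) ≤ dist (G s) (G t)) :
    AbsolutelyContinuousOnInterval φ a b := by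
  rw [absolutelyContinuousOnInterval_iff] at hG ⊢
  intro ε hε
  obtain ⟨δ, hδ, H⟩ := hG ε hε
  refine ⟨δ, hδ, fun E hE hlt => (Finset.sum_le_sum fun i hi => ?_).trans_lt (H E hE hlt)⟩
  exact h _ (hE.1 i hi).1 _ (hE.1 i hi).2

/-- If the increments of `φ` are bounded by the integrals of each `h n`, then they are bounded by
the integral of the infimum of the `h n`. -/
theorem ofReal_abs_sub_le_lintegral_iInf {φ : ℝ → ℝ} {h : ℕ → ℝ → ℝ≥0∞}
    (hm : ∀ n, Measurable (h n)) (hfin : ∀ n, ∫⁻ t in Icc (0 : ℝ) 1, h n t ≠ ∞)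
    (hφ : ∀ n a b, 0 ≤ a → a < b → b ≤ 1 →
      ENNReal.ofReal |φ b - φ a| ≤ ∫⁻ t in Icc a b, h n t) :
    ENNReal.ofReal |φ 1 - φ 0| ≤ ∫⁻ t in Icc (0 : ℝ) 1, ⨅ n, h n t := by
  let G : ℕ → ℝ → ℝ := fun n t => ∫ v in (0 : ℝ)..t, (h n v).toReal
  have hint : ∀ n, IntegrableOn (fun t => (h n t).toReal) (Icc 0 1) := fun n =>
    integrable_toReal_of_lintegral_ne_top (hm n).aemeasurable (hfin n)
  have hii : ∀ n {a b : ℝ}, 0 ≤ a → a ≤ b → b ≤ 1 →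
      IntervalIntegrable (fun t => (h n t).toReal) volume a b := fun n a b ha hab hb =>
    (intervalIntegrable_iff_integrableOn_Icc_of_le hab).2
      ((hint n).mono_set (Icc_subset_Icc ha hb))
  have hinc : ∀ n a b, 0 ≤ a → a ≤ b → b ≤ 1 → |φ b - φ a| ≤ |G n b - G n a| := by
    intro n a b ha hab hb
    rcases hab.eq_or_lt with rfl | hab'
    · simp
    have hGsub : G n b - G n a = ∫ v in a..b, (h n v).toReal := by
      have := intervalIntegral.integral_add_adjacent_intervals (hii n le_rfl ha (hab.trans hb))
        (hii n ha hab hb)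
      simp only [G]
      linarith
    have hfin' : ∫⁻ t in Icc a b, h n t ≠ ∞ :=
      ne_top_of_le_ne_top (hfin n) (lintegral_mono_set (Icc_subset_Icc ha hb))
    have h2 : ∫ v in a..b, (h n v).toReal = (∫⁻ t in Icc a b, h n t).toReal := by
      rw [intervalIntegral.integral_of_le hab, ← integral_Icc_eq_integral_Ioc,
        integral_toReal (hm n).aemeasurable
          (ae_lt_top (hm n) hfin')]
    rw [hGsub, h2, abs_of_nonneg ENNReal.toReal_nonneg]
    exact (ENNReal.ofReal_le_iff_le_toReal hfin').1 (hφ n a b ha hab' hb)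
  have hinc' : ∀ n, ∀ a ∈ Icc (0 : ℝ) 1, ∀ b ∈ Icc (0 : ℝ) 1, |φ a - φ b| ≤ |G n a - G n b| := by
    intro n a ha b hb
    rcases le_total a b with hab | hab
    · rw [abs_sub_comm, abs_sub_comm (G n a)]
      exact hinc n a b ha.1 hab hb.2
    · exact hinc n b a hb.1 hab ha.2
  have h01 : uIcc (0 : ℝ) 1 = Icc 0 1 := uIcc_of_le zero_le_one
  -- Domination by the single integral `G 0` gives absolute continuity. So `φ` is recovered from its
  -- derivative, which can be compared with all `h n` pointwise.
  have hac : AbsolutelyContinuousOnInterval φ 0 1 := by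
    refine absolutelyContinuousOnInterval_of_dist_le (G := G 0)
      ((hii 0 le_rfl zero_le_one le_rfl).absolutelyContinuousOnInterval_intervalIntegral
        (by simp)) ?_
    rw [h01]
    exact hinc' 0
  have hder : ∀ᵐ t : ℝ, t ∈ Icc (0 : ℝ) 1 → ∀ n, ‖deriv φ t‖ₑ ≤ h n t := by
    have h1 : ∀ᵐ t : ℝ, ∀ n, t ∈ Icc (0 : ℝ) 1 → HasDerivAt (G n) (h n t).toReal t := by
      rw [ae_all_iff]
      intro n
      filter_upwards [(hii n le_rfl zero_le_one le_rfl).ae_hasDerivAt_integral] with t ht htm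
      rw [h01] at ht
      exact ht htm 0 (by simp)
    have h2 : ∀ᵐ t : ℝ, ∀ n, t ∈ Icc (0 : ℝ) 1 → h n t < ∞ := by
      rw [ae_all_iff]
      intro n
      exact (ae_restrict_iff' measurableSet_Icc).1 (ae_lt_top (hm n) (hfin n))
    have h3 : ∀ᵐ t : ℝ, t ≠ 0 := by simp [ae_iff]
    have h4 : ∀ᵐ t : ℝ, t ≠ 1 := by simp [ae_iff]
    filter_upwards [hac.ae_differentiableAt, h1, h2, h3, h4] with t ht1 ht2 ht3 ht4 ht5 htm n
    rw [h01] at ht1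
    have hIoo : Icc (0 : ℝ) 1 ∈ 𝓝 t :=
      Icc_mem_nhds (lt_of_le_of_ne htm.1 ht4.symm) (lt_of_le_of_ne htm.2 ht5)
    have := abs_deriv_le_of_abs_sub_le (ht1 htm).hasDerivAt (ht2 n htm)
      (by filter_upwards [hIoo] with s hs using hinc' n s hs t htm)
    rw [abs_of_nonneg ENNReal.toReal_nonneg, ← Real.norm_eq_abs] at this
    rw [← ofReal_norm]
    exact (ENNReal.ofReal_le_iff_le_toReal (ht3 n htm).ne).2 this
  rw [← hac.integral_deriv_eq_sub, intervalIntegral.integral_of_le zero_le_one,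
    ← integral_Icc_eq_integral_Ioc, ← Real.norm_eq_abs, ofReal_norm]
  refine (enorm_integral_le_lintegral_enorm _).trans (lintegral_mono_ae ?_)
  refine (ae_restrict_iff' measurableSet_Icc).2 ?_
  filter_upwards [hder] with t ht htm using le_iInf (ht htm)

end Real

theorem pathIntegral_mono {X : Type*} [MetricSpace X] (γ : C(I, X)) {g h : X → ℝ≥0∞} (hgh : g ≤ h) :
    pathIntegral γ g ≤ pathIntegral γ h := by
  unfold pathIntegral
  gcongr
  exact hgh _

/-! ### Modulus of curve families and existence of minimal weak upper gradients. -/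

section Modulus

variable {X : Type*} [MetricSpace X] [MeasurableSpace X] {μ : Measure X} {p : ℝ}

theorem Admissible.modulus_le {Γ : Set C(I, X)} {ρ : X → ℝ≥0∞} (h : Admissible Γ ρ) :
    modulus p μ Γ ≤ ∫⁻ x, ρ x ^ p ∂μ := iInf₂_le ρ h

/-- Applied to curves that contain a subcurve from an exceptional family: these form an exceptional
family as well. -/
theorem modulus_le_of_forall_exists {Γ Γ' : Set C(I, X)}
    (h : ∀ γ ∈ Γ', ∃ τ ∈ Γ, ∀ ρ : X → ℝ≥0∞, pathIntegral τ ρ ≤ pathIntegral γ ρ) :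
    modulus p μ Γ' ≤ modulus p μ Γ := by
  refine le_iInf₂ fun ρ hρ => Admissible.modulus_le ⟨hρ.1, fun γ hγ => ?_⟩
  obtain ⟨τ, hτ, hle⟩ := h γ hγ
  exact (hρ.2 τ hτ).trans (hle ρ)

/-- The supremum of functions admissible for the pieces is admissible for the union. Its `p`-th
power is at most the sum of the `p`-th powers, so no triangle inequality in `L^p` is needed and
summable small energies suffice. -/
theorem modulus_iUnion_eq_zero (hp : 0 < p) {Γ : ℕ → Set C(I, X)}
    (h : ∀ n, modulus p μ (Γ n) = 0) : modulus p μ (⋃ n, Γ n) = 0 := by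
  refine nonpos_iff_eq_zero.1 (ENNReal.le_of_forall_pos_le_add fun ε hε _ => ?_)
  obtain ⟨δ, hδ, hsum⟩ := ENNReal.exists_pos_sum_of_countable' (ENNReal.coe_pos.2 hε).ne' ℕ
  have hex : ∀ n, ∃ ρ, Admissible (Γ n) ρ ∧ ∫⁻ x, ρ x ^ p ∂μ < δ n := by
    intro n
    have : modulus p μ (Γ n) < δ n := by rw [h]; exact hδ n
    simpa [modulus, iInf_lt_iff] using this
  choose ρ hρ hlt using hex
  have hadm : Admissible (⋃ n, Γ n) (fun x => ⨆ n, ρ n x) := by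
    refine ⟨Measurable.iSup fun n => (hρ n).1, fun γ hγ => ?_⟩
    obtain ⟨n, hn⟩ := mem_iUnion.1 hγ
    exact ((hρ n).2 γ hn).trans (pathIntegral_mono γ fun x => le_iSup (fun n => ρ n x) n)
  refine (hadm.modulus_le (p := p) (μ := μ)).trans ?_
  calc ∫⁻ x, (⨆ n, ρ n x) ^ p ∂μ ≤ ∫⁻ x, ∑' n, ρ n x ^ p ∂μ := by
        refine lintegral_mono fun x => ?_
        rw [← ENNReal.le_rpow_inv_iff hp]
        refine iSup_le fun n => ?_
        rw [ENNReal.le_rpow_inv_iff hp]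
        exact ENNReal.le_tsum n
    _ = ∑' n, ∫⁻ x, ρ n x ^ p ∂μ :=
        lintegral_tsum fun n => ((hρ n).1.pow_const p).aemeasurable
    _ ≤ ∑' n, δ n := ENNReal.tsum_le_tsum fun n => (hlt n).le
    _ ≤ 0 + ε := by rw [zero_add]; exact hsum.le

/-- Almost every curve has finite integral of a given `L^p` function. -/
theorem modulus_pathIntegral_eq_top (hp : 0 < p) {g : X → ℝ≥0∞} (hg : Measurable g)
    (hgp : ∫⁻ x, g x ^ p ∂μ < ∞) :
    modulus p μ {γ | Rectifiable γ ∧ pathIntegral γ g = ∞} = 0 := by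
  -- Every positive multiple of `g` is admissible, as its integrals along these curves are still
  -- infinite; then `c → 0`.
  have key : ∀ c : ℝ≥0, 0 < c → modulus p μ {γ | Rectifiable γ ∧ pathIntegral γ g = ∞} ≤
      (c : ℝ≥0∞) ^ p * ∫⁻ x, g x ^ p ∂μ := by
    intro c hc
    have hadm : Admissible {γ | Rectifiable γ ∧ pathIntegral γ g = ∞}
        (fun x => (c : ℝ≥0∞) * g x) := by
      refine ⟨hg.const_mul _, fun γ hγ => ?_⟩
      have : pathIntegral γ (fun x => (c : ℝ≥0∞) * g x) = c * pathIntegral γ g := by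
        unfold pathIntegral
        rw [lintegral_const_mul' _ _ ENNReal.coe_ne_top]
        ring
      rw [this, hγ.2, ENNReal.mul_top (by simpa using hc.ne')]
      exact le_top
    refine (hadm.modulus_le (p := p) (μ := μ)).trans (le_of_eq ?_)
    rw [← lintegral_const_mul' _ _ (ENNReal.rpow_ne_top_of_nonneg hp.le ENNReal.coe_ne_top)]
    simp_rw [ENNReal.mul_rpow_of_nonneg _ _ hp.le]
  have hlim : Tendsto (fun c : ℝ≥0 => (c : ℝ≥0∞) ^ p * ∫⁻ x, g x ^ p ∂μ) (𝓝[>] 0) (𝓝 0) := by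
    have h1 : Tendsto (fun c : ℝ≥0 => (c : ℝ≥0∞) ^ p) (𝓝[>] 0) (𝓝 0) := by
      have : Continuous fun c : ℝ≥0 => (c : ℝ≥0∞) ^ p :=
        (ENNReal.continuous_rpow_const).comp ENNReal.continuous_coe
      simpa [hp] using (this.tendsto 0).mono_left nhdsWithin_le_nhds
    simpa using ENNReal.Tendsto.mul_const h1 (Or.inr hgp.ne)
  exact nonpos_iff_eq_zero.1 (ge_of_tendsto hlim (by
    filter_upwards [self_mem_nhdsWithin] with c hc using key c hc))

theorem IsUpperGradient.isWeakUpperGradient (hp : 0 < p) {g : X → ℝ≥0∞} {f : X → EReal}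
    (h : IsUpperGradient g f) : IsWeakUpperGradient p μ g f := by
  refine ⟨h.1, ∅, by simp, ?_, fun γ hγ _ hc => h.2 γ hγ hc⟩
  have : Admissible (∅ : Set C(I, X)) (fun _ => 0) := ⟨measurable_const, by simp⟩
  simpa [hp] using this.modulus_le (p := p) (μ := μ)

variable [BorelSpace X]

/-- The countable infimum of `p`-weak upper gradients in `L^p` is a `p`-weak upper gradient. -/
theorem IsWeakUpperGradient.iInf (hp : 0 < p) {F : X → ℝ} {h : ℕ → X → ℝ≥0∞}
    (hh : ∀ n, IsWeakUpperGradient p μ (h n) (fun x => (F x : EReal)))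
    (hfin : ∀ n, ∫⁻ x, h n x ^ p ∂μ < ∞) :
    IsWeakUpperGradient p μ (fun x => ⨅ n, h n x) (fun x => (F x : EReal)) := by
  refine ⟨Measurable.iInf fun n => (hh n).1, ?_⟩
  choose Γ hΓr hΓ0 hΓ using fun n => (hh n).2
  -- The inequality is needed on all subcurves of `γ`, so curves with a subcurve in `Γ n` are
  -- excluded too. Excluding `B n` makes each `h n` integrable along `γ`.
  let A : ℕ → Set C(I, X) := fun n => {γ | Rectifiable γ ∧
    ∃ τ ∈ Γ n, ∀ ρ : X → ℝ≥0∞, pathIntegral τ ρ ≤ pathIntegral γ ρ}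
  let B : ℕ → Set C(I, X) := fun n => {γ | Rectifiable γ ∧ pathIntegral γ (h n) = ∞}
  have hA : ∀ n, modulus p μ (A n) = 0 := fun n =>
    nonpos_iff_eq_zero.1 ((modulus_le_of_forall_exists fun γ hγ => hγ.2).trans (hΓ0 n).le)
  have hAB : ∀ n, modulus p μ (A n ∪ B n) = 0 := by
    intro n
    have h0 : modulus p μ (⋃ m : ℕ, if m = 0 then A n else B n) = 0 := by
      refine modulus_iUnion_eq_zero hp fun m => ?_
      split_ifs
      exacts [hA n, modulus_pathIntegral_eq_top hp (hh n).1 (hfin n)]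
    refine nonpos_iff_eq_zero.1 ((modulus_le_of_forall_exists fun γ hγ => ⟨γ, ?_, fun _ => le_rfl⟩).trans
      h0.le)
    rcases hγ with hγ | hγ
    · exact mem_iUnion.2 ⟨0, by simpa using hγ⟩
    · exact mem_iUnion.2 ⟨1, by simpa using hγ⟩
  refine ⟨⋃ n, (A n ∪ B n), ?_, modulus_iUnion_eq_zero hp hAB, ?_⟩
  · intro γ hγ
    obtain ⟨n, hn | hn⟩ := mem_iUnion.1 hγ
    exacts [hn.1, hn.1]
  · intro γ hγ hnot hne
    have hnot' : ∀ n, γ ∉ A n ∧ γ ∉ B n := fun n =>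
      ⟨fun h' => hnot (mem_iUnion.2 ⟨n, Or.inl h'⟩), fun h' => hnot (mem_iUnion.2 ⟨n, Or.inr h'⟩)⟩
    have hpc := (lipschitzWith_param hγ).continuous
    have hmeas : ∀ n, Measurable fun t => curveLength γ * h n (param γ t) := fun n =>
      ((hh n).1.comp hpc.measurable).const_mul _
    have hint : ∀ n, ∫⁻ t in Icc (0 : ℝ) 1, curveLength γ * h n (param γ t) =
        pathIntegral γ (h n) := fun n => by
      rw [pathIntegral_eq_param, lintegral_const_mul' _ _ (ne_of_lt hγ)]
    have := ofReal_abs_sub_le_lintegral_iInf (φ := fun t => F (param γ t)) hmeas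
      (fun n htop => (hnot' n).2 ⟨hγ, (hint n).symm.trans htop⟩) (fun n a b ha hab hb => by
        obtain ⟨τ, hτr, hτ0, hτ1, hτ⟩ := exists_subcurve hγ ha hab hb
        have hτΓ : τ ∉ Γ n := fun hmem => (hnot' n).1 ⟨hγ, τ, hmem, fun ρ => by
          rw [hτ, pathIntegral_eq_param]
          gcongr⟩
        rw [lintegral_const_mul' _ _ (ne_of_lt hγ), ← hτ, ← hτ0, ← hτ1]
        by_cases hc : Nonconstant τ
        · have := hΓ n τ hτr hτΓ hc
          rwa [UpperGradientInequality, gap_coe] at this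
        · simp only [Nonconstant, not_exists, not_not] at hc
          rw [hc 1 0]
          simp)
    rw [UpperGradientInequality, gap_coe, ← param_zero hγ, ← param_one hγ]
    refine this.trans ?_
    rw [pathIntegral_eq_param, ← lintegral_const_mul' _ _ (ne_of_lt hγ)]
    refine lintegral_mono fun t => ?_
    rw [ENNReal.mul_iInf' (fun h' => absurd h' (ne_of_lt hγ)) (fun _ => inferInstance)]

/-- A real-valued function with a `p`-weak upper gradient in `L^p` has a minimal one. -/
theorem exists_isMinimalWeakUpperGradient (hp : 0 < p) {F : X → ℝ} {g₀ : X → ℝ≥0∞}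
    (hg₀ : IsWeakUpperGradient p μ g₀ (fun x => (F x : EReal)))
    (hg₀p : ∫⁻ x, g₀ x ^ p ∂μ < ∞) :
    ∃ g, IsMinimalWeakUpperGradient p μ g (fun x => (F x : EReal)) := by
  -- The infimum of a sequence whose energies approach `sInf S` is again a competitor, so it attains
  -- the least energy.
  let S : Set ℝ≥0∞ := {a | ∃ g, IsWeakUpperGradient p μ g (fun x => (F x : EReal)) ∧
    ∫⁻ x, g x ^ p ∂μ < ∞ ∧ ∫⁻ x, g x ^ p ∂μ = a}
  have hS : S.Nonempty := ⟨_, g₀, hg₀, hg₀p, rfl⟩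
  obtain ⟨u, -, hu, huS⟩ := exists_seq_tendsto_sInf hS (OrderBot.bddBelow S)
  choose h hh hhp hhu using huS
  have hle : ∀ n, ∫⁻ x, (⨅ n, h n x) ^ p ∂μ ≤ ∫⁻ x, h n x ^ p ∂μ := fun n =>
    lintegral_mono fun x => ENNReal.rpow_le_rpow (iInf_le _ n) hp.le
  have hinf := IsWeakUpperGradient.iInf hp hh hhp
  have hfin : ∫⁻ x, (⨅ n, h n x) ^ p ∂μ < ∞ := (hle 0).trans_lt (hhp 0)
  have hmin : ∫⁻ x, (⨅ n, h n x) ^ p ∂μ ≤ sInf S :=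
    ge_of_tendsto' hu fun n => (hle n).trans (hhu n).le
  refine ⟨fun x => ⨅ n, h n x, hinf, hfin, fun k hk hkp => ?_⟩
  -- The infimum of this sequence is the pointwise minimum of the candidate and `k`. It cannot have
  -- less energy than the candidate, so the two agree almost everywhere.
  let q : ℕ → X → ℝ≥0∞ := fun n => if n = 0 then fun x => ⨅ n, h n x else k
  have hq : IsWeakUpperGradient p μ (fun x => ⨅ n, q n x) (fun x => (F x : EReal)) := by
    refine IsWeakUpperGradient.iInf hp (fun n => ?_) (fun n => ?_)
    · by_cases hn : n = 0
      · simpa [q, hn] using hinf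
      · simpa [q, hn] using hk
    · by_cases hn : n = 0
      · simpa [q, hn] using hfin
      · simpa [q, hn] using hkp
  have hq0 : ∀ x, ⨅ n, q n x ≤ ⨅ n, h n x := fun x => (iInf_le _ 0).trans (by simp [q])
  have hq1 : ∀ x, ⨅ n, q n x ≤ k x := fun x => (iInf_le _ 1).trans (by simp [q])
  have hqp : ∫⁻ x, (⨅ n, q n x) ^ p ∂μ ≤ ∫⁻ x, (⨅ n, h n x) ^ p ∂μ :=
    lintegral_mono fun x => ENNReal.rpow_le_rpow (hq0 x) hp.le
  have heq := ae_eq_of_ae_le_of_lintegral_le (μ := μ)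
    (Eventually.of_forall fun x => ENNReal.rpow_le_rpow (hq0 x) hp.le)
    (hqp.trans_lt hfin).ne (hinf.1.pow_const p).aemeasurable
    (hmin.trans (sInf_le ⟨_, hq, hqp.trans_lt hfin, rfl⟩))
  filter_upwards [heq] with x hx
  rw [← ENNReal.rpow_left_injective hp.ne' hx]
  exact hq1 x

end Modulus

/-! ### Lipschitz approximation of lower semicontinuous weights from below. -/

section LipschitzApproximation

variable {X : Type*} [MetricSpace X]

/-- Lipschitz approximation from below of a function with values in `[0,∞]`. -/
def lipApprox (W : X → ℝ≥0∞) (n : ℕ) (x : X) : ℝ :=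
  ⨅ y, ((min (W y) n).toReal + n * dist x y)

theorem bddBelow_lipApprox (W : X → ℝ≥0∞) (n : ℕ) (x : X) :
    BddBelow (range fun y => (min (W y) n).toReal + n * dist x y) :=
  ⟨0, by rintro _ ⟨y, rfl⟩; positivity⟩

theorem lipApprox_nonneg (W : X → ℝ≥0∞) (n : ℕ) (x : X) : 0 ≤ lipApprox W n x :=
  Real.iInf_nonneg fun y => by positivity

theorem ofReal_lipApprox_le (W : X → ℝ≥0∞) (n : ℕ) (x : X) :
    ENNReal.ofReal (lipApprox W n x) ≤ W x := by
  have h := ciInf_le (bddBelow_lipApprox W n x) x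
  simp only [dist_self, mul_zero, add_zero] at h
  exact (ENNReal.ofReal_le_of_le_toReal h).trans (min_le_left _ _)

theorem lipschitzWith_lipApprox (W : X → ℝ≥0∞) (n : ℕ) : LipschitzWith n (lipApprox W n) := by
  refine LipschitzWith.of_le_add_mul _ fun x z => ?_
  have : Nonempty X := ⟨x⟩
  rw [← sub_le_iff_le_add]
  refine le_ciInf fun y => ?_
  have h := ciInf_le (bddBelow_lipApprox W n x) y
  have h2 : (n : ℝ) * dist x y ≤ n * (dist x z + dist z y) := by
    gcongr
    exact dist_triangle _ _ _
  simp only [NNReal.coe_natCast, lipApprox] at h ⊢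
  linarith

/-- In the infimum, points within `r` of `x` contribute at least `c` through `W`, and farther points
do so through the penalty `n * dist x y`. -/
theorem le_lipApprox {W : X → ℝ≥0∞} {n : ℕ} {x : X} {c r : ℝ} (hcn : c ≤ n) (hcr : c ≤ n * r)
    (h : ∀ y, dist x y < r → ENNReal.ofReal c ≤ W y) : c ≤ lipApprox W n x := by
  have : Nonempty X := ⟨x⟩
  refine le_ciInf fun y => ?_
  rcases lt_or_ge (dist x y) r with hy | hy
  · have h1 : ENNReal.ofReal c ≤ min (W y) n :=
      le_min (h y hy) (by simpa using ENNReal.ofReal_le_ofReal hcn)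
    have h2 := (ENNReal.ofReal_le_iff_le_toReal
      (ne_top_of_le_ne_top (ENNReal.natCast_ne_top n) (min_le_right _ _))).1 h1
    have : (0 : ℝ) ≤ n * dist x y := by positivity
    linarith
  · have : (n : ℝ) * r ≤ n * dist x y := by gcongr
    have : 0 ≤ (min (W y) n).toReal := ENNReal.toReal_nonneg
    linarith

/-- The Lipschitz approximations of a lower semicontinuous function recover it, even along
converging points. -/
theorem le_liminf_lipApprox {W : X → ℝ≥0∞} (hW : LowerSemicontinuous W) {φ : ℕ → ℕ}
    (hφ : Tendsto φ atTop atTop) {z : ℕ → X} {x : X} (hz : Tendsto z atTop (𝓝 x)) :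
    W x ≤ liminf (fun j => ENNReal.ofReal (lipApprox W (φ j) (z j))) atTop := by
  refine le_of_forall_lt fun a ha => ?_
  obtain ⟨b, hab, hb⟩ := exists_between ha
  have hbt : b ≠ ∞ := (hb.trans_le le_top).ne
  refine hab.trans_le (le_liminf_of_le (by isBoundedDefault) ?_)
  obtain ⟨r, hr, hball⟩ := Metric.eventually_nhds_iff.1 (hW x b hb)
  have h1 : ∀ᶠ j in atTop, dist (z j) x < r / 2 := Metric.tendsto_nhds.1 hz _ (half_pos hr)
  have hφ' : Tendsto (fun j => (φ j : ℝ)) atTop atTop := tendsto_natCast_atTop_atTop.comp hφ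
  have h3 : ∀ᶠ j in atTop, b.toReal ≤ (φ j : ℝ) * (r / 2) :=
    (hφ'.atTop_mul_const (half_pos hr)).eventually_ge_atTop _
  filter_upwards [h1, hφ'.eventually_ge_atTop b.toReal, h3] with j hj1 hj2 hj3
  rw [← ENNReal.ofReal_toReal hbt]
  refine ENNReal.ofReal_le_ofReal (le_lipApprox hj2 hj3 fun y hy => ?_)
  rw [ENNReal.ofReal_toReal hbt]
  refine (hball ?_).le
  rw [dist_comm] at hy
  linarith [dist_triangle y (z j) x]

end LipschitzApproximation

/-! ### Discrete paths, their cost and the discrete extension. -/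

section Chains

variable {X : Type*} [MetricSpace X]

/-- The cost of the discrete path `q 0, …, q k` with weight `w`. -/
def chainCost (w : X → ℝ) (q : ℕ → X) (k : ℕ) : ℝ :=
  ∑ i ∈ Finset.range k, w (q i) * dist (q i) (q (i + 1))

theorem chainCost_nonneg {w : X → ℝ} (hw : ∀ x, 0 ≤ w x) (q : ℕ → X) (k : ℕ) :
    0 ≤ chainCost w q k :=
  Finset.sum_nonneg fun _ _ => mul_nonneg (hw _) dist_nonneg

/-- The values `f (q 0) + cost` of the discrete paths from `A` to `x` with steps at most `δ`. -/
def chainValues (A : Set X) (f w : X → ℝ) (δ : ℝ) (x : X) : Set ℝ :=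
  {c | ∃ (q : ℕ → X) (k : ℕ), q 0 ∈ A ∧ q k = x ∧ (∀ i < k, dist (q i) (q (i + 1)) ≤ δ) ∧
    c = f (q 0) + chainCost w q k}

/-- The largest extension of `f|_A` with slope `w` at scale `δ`, truncated at the level `M`. -/
def chainExtension (A : Set X) (f w : X → ℝ) (M δ : ℝ) (x : X) : ℝ :=
  sInf (insert M (chainValues A f w δ x))

variable {A : Set X} {f w : X → ℝ} {M δ : ℝ}

theorem neg_mem_lowerBounds (hf : ∀ x, |f x| ≤ M) (hw : ∀ x, 0 ≤ w x) (x : X) :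
    -M ∈ lowerBounds (insert M (chainValues A f w δ x)) := by
  have hM : 0 ≤ M := (abs_nonneg _).trans (hf x)
  rintro c (rfl | ⟨q, k, -, -, -, rfl⟩)
  · linarith
  · have := (abs_le.1 (hf (q 0))).1
    have := chainCost_nonneg hw q k
    linarith

theorem chainExtension_le (hf : ∀ x, |f x| ≤ M) (hw : ∀ x, 0 ≤ w x) {x : X} {c : ℝ}
    (hc : c ∈ insert M (chainValues A f w δ x)) : chainExtension A f w M δ x ≤ c :=
  csInf_le ⟨_, neg_mem_lowerBounds hf hw x⟩ hc

theorem abs_chainExtension_le (hf : ∀ x, |f x| ≤ M) (hw : ∀ x, 0 ≤ w x) (x : X) :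
    |chainExtension A f w M δ x| ≤ M :=
  abs_le.2 ⟨le_csInf (insert_nonempty _ _) (neg_mem_lowerBounds hf hw x),
    chainExtension_le hf hw (mem_insert _ _)⟩

theorem chainExtension_le_self (hf : ∀ x, |f x| ≤ M) (hw : ∀ x, 0 ≤ w x) {x : X} (hx : x ∈ A) :
    chainExtension A f w M δ x ≤ f x :=
  chainExtension_le hf hw (mem_insert_of_mem _
    ⟨fun _ => x, 0, hx, rfl, by simp, by simp [chainCost]⟩)

theorem exists_chain_of_chainExtension_lt {x : X} {c : ℝ} (h : chainExtension A f w M δ x < c)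
    (hc : c ≤ M) : ∃ (q : ℕ → X) (k : ℕ), q 0 ∈ A ∧ q k = x ∧
      (∀ i < k, dist (q i) (q (i + 1)) ≤ δ) ∧ f (q 0) + chainCost w q k < c := by
  obtain ⟨b, rfl | ⟨q, k, h0, hk, hd, rfl⟩, hb⟩ := exists_lt_of_csInf_lt (insert_nonempty _ _) h
  · exact absurd hb (not_lt.2 hc)
  · exact ⟨q, k, h0, hk, hd, hb⟩

/-- A discrete path ending at `x` can be prolonged by the step to `z`, which costs `w x * dist x z`
because the weight is taken at the start of a step. -/
theorem chainExtension_le_add (hf : ∀ x, |f x| ≤ M) (hw : ∀ x, 0 ≤ w x) {x z : X}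
    (hxz : dist x z ≤ δ) :
    chainExtension A f w M δ z ≤ chainExtension A f w M δ x + w x * dist x z := by
  have h0 : 0 ≤ w x * dist x z := mul_nonneg (hw x) dist_nonneg
  rw [← sub_le_iff_le_add]
  refine le_csInf (insert_nonempty _ _) ?_
  rintro c (rfl | ⟨q, k, hA, rfl, hd, rfl⟩) <;> rw [sub_le_iff_le_add]
  · exact (chainExtension_le hf hw (mem_insert _ _)).trans (by linarith)
  · have hup : ∀ i ≤ k, Function.update q (k + 1) z i = q i := fun i hi =>
      Function.update_of_ne (by omega) _ _
    refine chainExtension_le hf hw (mem_insert_of_mem _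
      ⟨Function.update q (k + 1) z, k + 1, ?_, by simp, fun i hi => ?_, ?_⟩)
    · rwa [hup 0 (Nat.zero_le _)]
    · rcases (Nat.lt_succ_iff.1 hi).eq_or_lt with rfl | hik
      · simpa [hup i le_rfl] using hxz
      · rw [hup i hik.le, hup (i + 1) hik]
        exact hd i hik
    · rw [hup 0 (Nat.zero_le _), add_assoc]
      congr 1
      symm
      rw [chainCost, Finset.sum_range_succ, hup k le_rfl, Function.update_self, chainCost]
      congr 1
      refine Finset.sum_congr rfl fun i hi => ?_
      have hik := Finset.mem_range.1 hi
      rw [hup i hik.le, hup (i + 1) hik]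

theorem abs_chainExtension_sub_le (hf : ∀ x, |f x| ≤ M) (hw : ∀ x, 0 ≤ w x) {x z : X}
    (hxz : dist x z ≤ δ) :
    |chainExtension A f w M δ z - chainExtension A f w M δ x| ≤ max (w x) (w z) * dist x z := by
  have h1 := chainExtension_le_add (A := A) hf hw hxz
  have h2 := chainExtension_le_add (A := A) hf hw (dist_comm x z ▸ hxz)
  rw [dist_comm z x] at h2
  have h3 : w x * dist x z ≤ max (w x) (w z) * dist x z := by gcongr; exact le_max_left _ _
  have h4 : w z * dist x z ≤ max (w x) (w z) * dist x z := by gcongr; exact le_max_right _ _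
  exact abs_le.2 ⟨by linarith, by linarith⟩

end Chains

/-! ### From a slope bound at small scales to the upper gradient inequality. -/

section LocalSlope

variable {X : Type*} [MetricSpace X] {u w : X → ℝ} {δ : ℝ}

theorem continuous_of_abs_sub_le (hw : Continuous w) (hδ : 0 < δ)
    (h : ∀ x z, dist x z ≤ δ → |u z - u x| ≤ max (w x) (w z) * dist x z) : Continuous u := by
  rw [continuous_iff_continuousAt]
  intro x
  rw [ContinuousAt, tendsto_iff_dist_tendsto_zero]
  have hlim : Tendsto (fun z => max (w x) (w z) * dist x z) (𝓝 x) (𝓝 0) := by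
    have : Continuous fun z => max (w x) (w z) * dist x z := by fun_prop
    simpa using this.tendsto x
  refine squeeze_zero' (Eventually.of_forall fun _ => dist_nonneg) ?_ hlim
  filter_upwards [closedBall_mem_nhds x hδ] with z hz
  exact h x z (by rwa [dist_comm])

/-- By continuity of `w`, the right difference quotients of `u ∘ κ` at each point are asymptotically
at most `L * w (κ x)`. A comparison principle bounds the function by the antiderivative of this
bound. -/
theorem sub_le_integral_param (hu : Continuous u) (hw : Continuous w) (hδ : 0 < δ)
    (hw0 : ∀ x, 0 ≤ w x) (h : ∀ x z, dist x z ≤ δ → |u z - u x| ≤ max (w x) (w z) * dist x z)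
    {κ : ℝ → X} {L : ℝ≥0} (hσ : LipschitzWith L κ) :
    u (κ 1) - u (κ 0) ≤ ∫ t in (0 : ℝ)..1, L * w (κ t) := by
  have hσc := hσ.continuous
  have hc : Continuous fun t => L * w (κ t) := by fun_prop
  have hder : ∀ x : ℝ, HasDerivAt (fun t => u (κ 0) + ∫ s in (0 : ℝ)..t, L * w (κ s))
      (L * w (κ x)) x := fun x =>
    (intervalIntegral.integral_hasDerivAt_right (hc.intervalIntegrable _ _)
      hc.stronglyMeasurable.stronglyMeasurableAtFilter hc.continuousAt).const_add _
  have := image_le_of_liminf_slope_right_le_deriv_boundary (f := fun t => u (κ t)) (a := 0) (b := 1)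
    (by fun_prop) (B := fun t => u (κ 0) + ∫ s in (0 : ℝ)..t, L * w (κ s))
    (B' := fun t => L * w (κ t)) (by simp)
    (fun x _ => (hder x).continuousAt.continuousWithinAt)
    (fun x _ => (hder x).hasDerivWithinAt) (fun x _ r hr => ?_) (right_mem_Icc.2 zero_le_one)
  · linarith
  · refine Eventually.frequently ?_
    have h1 : ∀ᶠ z in 𝓝 x, L * max (w (κ x)) (w (κ z)) < r := by
      have hc' : Continuous fun z => L * max (w (κ x)) (w (κ z)) := by fun_prop
      exact hc'.continuousAt.eventually_lt continuousAt_const (by simpa using hr)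
    have h2 : ∀ᶠ z in 𝓝 x, dist (κ x) (κ z) < δ := by
      have hc' : Continuous fun z => dist (κ x) (κ z) := by fun_prop
      exact hc'.continuousAt.eventually_lt continuousAt_const (by simpa using hδ)
    filter_upwards [h1.filter_mono nhdsWithin_le_nhds, h2.filter_mono nhdsWithin_le_nhds,
      self_mem_nhdsWithin] with z hz1 hz2 hz3
    have hxz : 0 < z - x := sub_pos.2 hz3
    rw [slope_def_field, div_lt_iff₀ hxz]
    have h3 := (le_abs_self _).trans (h _ _ hz2.le)
    have h4 : dist (κ x) (κ z) ≤ L * (z - x) := by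
      have := hσ.dist_le_mul x z
      rwa [Real.dist_eq, abs_sub_comm, abs_of_pos hxz] at this
    have h5 : max (w (κ x)) (w (κ z)) * dist (κ x) (κ z) ≤
        max (w (κ x)) (w (κ z)) * (L * (z - x)) :=
      mul_le_mul_of_nonneg_left h4 (le_max_of_le_left (hw0 _))
    nlinarith

/-- A function with slope at most `w` at small scales satisfies the upper gradient inequality. -/
theorem ofReal_abs_sub_le_pathIntegral (hu : Continuous u) (hw : Continuous w) (hδ : 0 < δ)
    (hw0 : ∀ x, 0 ≤ w x) (h : ∀ x z, dist x z ≤ δ → |u z - u x| ≤ max (w x) (w z) * dist x z)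
    {γ : C(I, X)} (hγ : Rectifiable γ) :
    ENNReal.ofReal |u (γ 1) - u (γ 0)| ≤ pathIntegral γ fun x => ENNReal.ofReal (w x) := by
  have hσ := lipschitzWith_param hγ
  have hσc := hσ.continuous
  have h1 := sub_le_integral_param hu hw hδ hw0 h hσ
  have h2 := sub_le_integral_param (u := fun x => -u x) hu.neg hw hδ hw0
    (fun x z hxz => by
      have := h x z hxz
      rwa [← abs_neg, show -(-u z - -u x) = u z - u x by ring]) hσ
  rw [param_zero hγ, param_one hγ] at h1 h2
  have h3 : |u (γ 1) - u (γ 0)| ≤ ∫ t in (0 : ℝ)..1, (curveLength γ).toNNReal * w (param γ t) :=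
    abs_le.2 ⟨by linarith, h1⟩
  have hc : Continuous fun t => (curveLength γ).toNNReal * w (param γ t) := by fun_prop
  refine (ENNReal.ofReal_le_ofReal h3).trans (le_of_eq ?_)
  rw [intervalIntegral.integral_of_le zero_le_one, ← integral_Icc_eq_integral_Ioc,
    ofReal_integral_eq_lintegral_ofReal (hc.continuousOn.integrableOn_compact isCompact_Icc)
      (Eventually.of_forall fun t => mul_nonneg (by positivity) (hw0 _)),
    pathIntegral_eq_param, ← lintegral_const_mul' _ _ (ne_of_lt hγ)]
  congr 1
  ext t
  rw [ENNReal.ofReal_mul (by positivity), ENNReal.ofReal_coe_nnreal,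
    ENNReal.coe_toNNReal (ne_of_lt hγ)]

end LocalSlope

/-! ### Discrete paths as step functions of their length. -/

section StepCurve

variable {X : Type*} [MetricSpace X]

/-- The length of the discrete path `q 0, …, q k`. -/
def chainLength (q : ℕ → X) (k : ℕ) : ℝ := ∑ i ∈ Finset.range k, dist (q i) (q (i + 1))

theorem monotone_chainLength (q : ℕ → X) : Monotone (chainLength q) :=
  monotone_nat_of_le_succ fun n => by
    rw [chainLength, chainLength, Finset.sum_range_succ]
    exact le_add_of_nonneg_right dist_nonneg

theorem chainLength_zero (q : ℕ → X) : chainLength q 0 = 0 := by simp [chainLength]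

theorem chainLength_nonneg (q : ℕ → X) (k : ℕ) : 0 ≤ chainLength q k :=
  Finset.sum_nonneg fun _ _ => dist_nonneg

theorem dist_le_chainLength_sub (q : ℕ → X) {i j : ℕ} (hij : i ≤ j) :
    dist (q i) (q j) ≤ chainLength q j - chainLength q i := by
  rw [chainLength, chainLength, ← Finset.sum_Ico_eq_sub _ hij]
  exact dist_le_Ico_sum_dist q hij

/-- The index of the last point of the discrete path `q 0, …, q k` reached at length `s`. -/
def stepIndex (q : ℕ → X) (k : ℕ) (s : ℝ) : ℕ :=
  open scoped Classical in Nat.findGreatest (fun i => chainLength q i ≤ s) k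

/-- The discrete path `q 0, …, q k` as a step function of its length. -/
def stepCurve (q : ℕ → X) (k : ℕ) (s : ℝ) : X := q (stepIndex q k s)

theorem stepIndex_le (q : ℕ → X) (k : ℕ) (s : ℝ) : stepIndex q k s ≤ k :=
  Nat.findGreatest_le k

theorem monotone_stepIndex (q : ℕ → X) (k : ℕ) : Monotone (stepIndex q k) := fun _ _ hst =>
  Nat.findGreatest_mono (fun _ hi => hi.trans hst) le_rfl

theorem chainLength_stepIndex_le (q : ℕ → X) (k : ℕ) {s : ℝ} (hs : 0 ≤ s) :
    chainLength q (stepIndex q k s) ≤ s := by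
  classical
  exact Nat.findGreatest_spec (P := fun i => chainLength q i ≤ s) (Nat.zero_le k)
    (by simpa [chainLength_zero] using hs)

theorem stepIndex_eq (q : ℕ → X) {k i : ℕ} (hi : i < k) {s : ℝ}
    (hs : s ∈ Ico (chainLength q i) (chainLength q (i + 1))) : stepIndex q k s = i := by
  classical
  refine Nat.findGreatest_eq_iff.2 ⟨hi.le, fun _ => hs.1, fun n hn _ hle => ?_⟩
  exact absurd (hs.2.trans_le (monotone_chainLength q hn)) (not_lt.2 hle)

theorem stepIndex_of_le (q : ℕ → X) {k : ℕ} {s : ℝ} (hs : chainLength q k ≤ s) :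
    stepIndex q k s = k := by
  classical
  exact Nat.findGreatest_eq hs

/-- Initial steps of length zero may make the index at `0` positive, but the points passed over all
coincide with `q 0`. -/
theorem stepCurve_zero (q : ℕ → X) (k : ℕ) : stepCurve q k 0 = q 0 := by
  have h := dist_le_chainLength_sub q (Nat.zero_le (stepIndex q k 0))
  have h2 := chainLength_stepIndex_le q k le_rfl
  rw [chainLength_zero] at h
  exact (dist_le_zero.1 (by rw [stepCurve]; linarith)).symm

theorem stepCurve_chainLength (q : ℕ → X) (k : ℕ) : stepCurve q k (chainLength q k) = q k := by
  rw [stepCurve, stepIndex_of_le q le_rfl]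

/-- The step function runs behind the length parameter by at most one step, so it is 1-Lipschitz up
to the error `δ`. -/
theorem dist_stepCurve_le {q : ℕ → X} {k : ℕ} {δ : ℝ} (hδ : 0 ≤ δ)
    (hq : ∀ i < k, dist (q i) (q (i + 1)) ≤ δ) (s t : ℝ) :
    dist (stepCurve q k s) (stepCurve q k t) ≤ |s - t| + δ := by
  wlog hst : s ≤ t generalizing s t
  · rw [dist_comm, abs_sub_comm]
    exact this t s (le_of_not_ge hst)
  rw [abs_sub_comm, abs_of_nonneg (sub_nonneg.2 hst)]
  have hmono := monotone_stepIndex q k hst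
  rcases hmono.eq_or_lt with heq | hlt
  · rw [stepCurve, stepCurve, heq, dist_self]
    linarith
  have hsk : stepIndex q k s < k := hlt.trans_le (stepIndex_le q k t)
  have h1 := dist_le_chainLength_sub q hmono
  have h2 : s < chainLength q (stepIndex q k s + 1) := by
    by_contra! hcon
    classical
    have := Nat.le_findGreatest (P := fun i => chainLength q i ≤ s) hsk hcon
    exact absurd this (by simp [stepIndex])
  have h3 : chainLength q (stepIndex q k s + 1) ≤ chainLength q (stepIndex q k s) + δ := by
    rw [chainLength, Finset.sum_range_succ, ← chainLength]
    gcongr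
    exact hq _ hsk
  have h4 : chainLength q (stepIndex q k t) ≤ t := by
    refine chainLength_stepIndex_le q k ?_
    -- For negative `t` no index qualifies and `Nat.findGreatest` returns its default `0`, which
    -- cannot exceed the index at `s`.
    by_contra! hneg
    have : stepIndex q k t = 0 := by
      classical
      refine Nat.findGreatest_eq_zero_iff.2 fun n _ _ hle => ?_
      exact absurd (chainLength_nonneg q n) (not_le.2 (hle.trans_lt hneg))
    omega
  rw [stepCurve, stepCurve]
  linarith

theorem measurable_comp_stepCurve {β : Type*} [MeasurableSpace β] (w : X → β) (q : ℕ → X) (k : ℕ) :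
    Measurable fun s => w (stepCurve q k s) :=
  (measurable_from_nat (f := fun i => w (q i))).comp (monotone_stepIndex q k).measurable

/-- On each half-open interval of lengths the step function sits at the starting point of the step,
which is where the cost evaluates the weight. -/
theorem lintegral_stepCurve {w : X → ℝ} (hw : ∀ x, 0 ≤ w x) (q : ℕ → X) (k : ℕ) :
    ∫⁻ s in Ico 0 (chainLength q k), ENNReal.ofReal (w (stepCurve q k s)) =
      ENNReal.ofReal (chainCost w q k) := by
  have key : ∀ i ≤ k, ∫⁻ s in Ico 0 (chainLength q i), ENNReal.ofReal (w (stepCurve q k s)) =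
      ENNReal.ofReal (chainCost w q i) := by
    intro i
    induction i with
    | zero => simp [chainLength_zero, chainCost]
    | succ i ih =>
      intro hi
      have hle := monotone_chainLength q (Nat.le_succ i)
      rw [← Ico_union_Ico_eq_Ico (chainLength_nonneg q i) hle,
        lintegral_union measurableSet_Ico (Ico_disjoint_Ico_same), ih (by omega)]
      have h1 : ∫⁻ s in Ico (chainLength q i) (chainLength q (i + 1)),
          ENNReal.ofReal (w (stepCurve q k s)) =
          ∫⁻ s in Ico (chainLength q i) (chainLength q (i + 1)), ENNReal.ofReal (w (q i)) := by
        refine setLIntegral_congr_fun measurableSet_Ico fun s hs => ?_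
        simp only [stepCurve, stepIndex_eq q hi hs]
      have h2 : chainLength q (i + 1) - chainLength q i = dist (q i) (q (i + 1)) := by
        rw [chainLength, chainLength, Finset.sum_range_succ]
        ring
      rw [h1, setLIntegral_const, Real.volume_Ico, h2, ← ENNReal.ofReal_mul (hw _),
        ← ENNReal.ofReal_add (chainCost_nonneg hw q i) (mul_nonneg (hw _) dist_nonneg), chainCost,
        chainCost, Finset.sum_range_succ]
  exact key k le_rfl

end StepCurve

/-! ### Confinement of discrete paths and compactness of step functions. -/

section Compactness

variable {X : Type*} [MetricSpace X]

/-- `D` stands for the distance to a set outside whose `r`-neighbourhood the weight is at least `N`.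
Moving away there costs at least `N` per unit of distance. A step from inside the neighbourhood ends
where `D ≤ 2 * r`, and then the left side is not positive. -/
theorem chainCost_ge_of_start {w D : X → ℝ} {q : ℕ → X} {k : ℕ} {N r : ℝ} (hN : 0 ≤ N)
    (hw0 : ∀ x, 0 ≤ w x) (hD : ∀ x y, D x ≤ D y + dist x y) (hw : ∀ x, r ≤ D x → N ≤ w x)
    (hq : ∀ i < k, dist (q i) (q (i + 1)) ≤ r) (h0 : D (q 0) ≤ 2 * r) :
    ∀ i ≤ k, N * (D (q i) - 2 * r) ≤ chainCost w q i := by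
  intro i
  induction i with
  | zero => intro _; simp only [chainCost, Finset.range_zero, Finset.sum_empty]; nlinarith
  | succ i ih =>
    intro hi
    have h1 := hD (q (i + 1)) (q i)
    rw [dist_comm] at h1
    have h2 := hq i hi
    rcases le_or_gt r (D (q i)) with hr | hr
    · rw [chainCost, Finset.sum_range_succ, ← chainCost]
      have h3 := ih (by omega)
      have h4 : N * dist (q i) (q (i + 1)) ≤ w (q i) * dist (q i) (q (i + 1)) := by
        gcongr; exact hw _ hr
      nlinarith
    · have h3 := chainCost_nonneg hw0 q (i + 1)
      nlinarith

/-- The counterpart when only the last point is near the set, by induction backwards along the path.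
It is not a mere reversal, since the cost weighs each step at its starting point. -/
theorem chainCost_ge_of_end {w D : X → ℝ} {q : ℕ → X} {k : ℕ} {N r : ℝ} (hN : 0 ≤ N) (hr0 : 0 ≤ r)
    (hw0 : ∀ x, 0 ≤ w x) (hD : ∀ x y, D x ≤ D y + dist x y) (hw : ∀ x, r ≤ D x → N ≤ w x)
    (hk : D (q k) ≤ 2 * r) :
    ∀ i ≤ k, N * (D (q i) - 2 * r) ≤ chainCost w q k := by
  have hmono : Monotone (chainCost w q) := monotone_nat_of_le_succ fun n => by
    rw [chainCost, chainCost, Finset.sum_range_succ]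
    exact le_add_of_nonneg_right (mul_nonneg (hw0 _) dist_nonneg)
  have key : ∀ i ≤ k, N * (D (q i) - 2 * r) ≤ chainCost w q k - chainCost w q i := by
    intro i hi
    induction hi using Nat.decreasingInduction with
    | self => nlinarith
    | of_succ i hi ih =>
      rcases le_or_gt r (D (q i)) with hr | hr
      · have h1 := hD (q i) (q (i + 1))
        have h4 : N * dist (q i) (q (i + 1)) ≤ w (q i) * dist (q i) (q (i + 1)) := by
          gcongr; exact hw _ hr
        have h5 : chainCost w q (i + 1) = chainCost w q i + w (q i) * dist (q i) (q (i + 1)) := by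
          rw [chainCost, Finset.sum_range_succ, ← chainCost]
        nlinarith
      · have h3 := hmono hi.le
        nlinarith
  intro i hi
  have := chainCost_nonneg hw0 q i
  linarith [key i hi]

/-- A sequence of finite sets that come arbitrarily close to compact sets stays in a compact set. -/
theorem isCompact_closure_iUnion [CompleteSpace X] {s : ℕ → Set X} (hs : ∀ n, (s n).Finite)
    (h : ∀ ε > 0, ∃ K : Set X, IsCompact K ∧ ∃ n₀, ∀ n ≥ n₀, ∀ x ∈ s n, ∃ y ∈ K, dist x y < ε) :
    IsCompact (closure (⋃ n, s n)) := by
  refine TotallyBounded.isCompact_of_isClosed (TotallyBounded.closure ?_) isClosed_closure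
  rw [Metric.totallyBounded_iff]
  intro ε hε
  obtain ⟨K, hK, n₀, hn₀⟩ := h (ε / 2) (half_pos hε)
  obtain ⟨t, ht, hKt⟩ := Metric.totallyBounded_iff.1 hK.totallyBounded (ε / 2) (half_pos hε)
  -- The first `n₀` sets are finite and serve as their own net; the later ones are covered through a
  -- net of `K`.
  refine ⟨t ∪ ⋃ n ∈ Finset.range n₀, s n,
    ht.union (Set.Finite.biUnion (Finset.finite_toSet _) fun n _ => hs n), ?_⟩
  intro x hx
  obtain ⟨n, hn⟩ := mem_iUnion.1 hx
  rcases lt_or_ge n n₀ with hlt | hge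
  · exact mem_biUnion (Or.inr (mem_biUnion (Finset.mem_coe.2 (Finset.mem_range.2 hlt)) hn))
      (mem_ball_self hε)
  · obtain ⟨y, hy, hxy⟩ := hn₀ n hge x hn
    obtain ⟨z, hz, hyz⟩ := mem_iUnion₂.1 (hKt hy)
    refine mem_biUnion (Or.inl hz) ?_
    rw [mem_ball] at hyz ⊢
    linarith [dist_triangle x y z]

/-- A compactness theorem for functions on the line that are asymptotically 1-Lipschitz. -/
theorem exists_tendsto_subseq_of_asymptotically_lipschitz [CompleteSpace X] {Q : Set X}
    (hQ : IsCompact Q) {c : ℕ → ℝ → X} (hcQ : ∀ n s, c n s ∈ Q) {δ : ℕ → ℝ}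
    (hδ : Tendsto δ atTop (𝓝 0)) (hc : ∀ n s t, dist (c n s) (c n t) ≤ |s - t| + δ n) :
    ∃ (φ : ℕ → ℕ) (κ : ℝ → X), StrictMono φ ∧ LipschitzWith 1 κ ∧
      ∀ s, Tendsto (fun j => c (φ j) s) atTop (𝓝 (κ s)) := by
  -- Compactness of the countable product `Q^ℚ` yields convergence at all rationals. The asymptotic
  -- Lipschitz bound extends it to all reals.
  obtain ⟨a, -, φ, hφ, ha⟩ := (isCompact_univ_pi fun _ : ℚ => hQ).tendsto_subseq
    (x := fun n (r : ℚ) => c n r) fun n r _ => hcQ n r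
  rw [tendsto_pi_nhds] at ha
  have hlim : ∀ s, ∃ x, Tendsto (fun j => c (φ j) s) atTop (𝓝 x) := by
    intro s
    refine cauchySeq_tendsto_of_complete (Metric.cauchySeq_iff'.2 fun ε hε => ?_)
    obtain ⟨r, hr1, hr2⟩ := exists_rat_btwn (show s < s + ε / 8 by linarith)
    have h1 : ∀ᶠ j in atTop, dist (c (φ j) r) (a r) < ε / 8 :=
      Metric.tendsto_nhds.1 (ha r) _ (by linarith)
    have h2 : ∀ᶠ j in atTop, δ (φ j) < ε / 8 :=
      (hδ.comp hφ.tendsto_atTop).eventually_lt_const (by linarith)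
    obtain ⟨j₀, hj₀⟩ := (h1.and h2).exists_forall_of_atTop
    have hsr : |s - r| < ε / 8 := by
      rw [abs_sub_comm, abs_of_pos (by linarith)]; linarith
    refine ⟨j₀, fun j hj => ?_⟩
    have h3 := hj₀ j hj
    have h4 := hj₀ j₀ le_rfl
    have h5 := hc (φ j) s r
    have h6 := hc (φ j₀) s r
    rw [dist_comm] at h6
    have h7 := dist_triangle4 (c (φ j) s) (c (φ j) r) (c (φ j₀) r) (c (φ j₀) s)
    have h8 := dist_triangle_right (c (φ j) r) (c (φ j₀) r) (a r)
    linarith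
  choose κ hκ using hlim
  refine ⟨φ, κ, hφ, LipschitzWith.of_dist_le_mul fun s t => ?_, hκ⟩
  have h1 := ((hδ.comp hφ.tendsto_atTop).const_add |s - t|)
  simp only [NNReal.coe_one, one_mul, Real.dist_eq]
  rw [add_zero] at h1
  exact le_of_tendsto_of_tendsto' ((hκ s).dist (hκ t)) h1 fun j => hc (φ j) s t

variable [MeasurableSpace X] [BorelSpace X]

/-- The path integral of a curve given with a Lipschitz parametrization on `[0, l]`. -/
theorem exists_curve_pathIntegral_le {κ : ℝ → X} (hκ : LipschitzWith 1 κ) {l : ℝ} (hl : 0 ≤ l)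
    {g : X → ℝ≥0∞} (hg : Measurable g) :
    ∃ γ : C(I, X), Rectifiable γ ∧ γ 0 = κ 0 ∧ γ 1 = κ l ∧
      pathIntegral γ g ≤ ∫⁻ s in Ico 0 l, g (κ s) := by
  have hκc := hκ.continuous
  let γ : C(I, X) := ⟨fun u => κ (l * u), by fun_prop⟩
  have hlip : LipschitzWith l.toNNReal γ := by
    refine LipschitzWith.of_dist_le_mul fun s t => ?_
    have := hκ.dist_le_mul (l * s) (l * t)
    rw [Real.coe_toNNReal _ hl]
    rw [Real.dist_eq, ← mul_sub, abs_mul, abs_of_nonneg hl, NNReal.coe_one, one_mul] at this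
    exact this
  obtain ⟨hr, hle⟩ := pathIntegral_le_of_lipschitzWith hlip hg
  refine ⟨γ, hr, by simp [γ], by simp [γ], hle.trans ?_⟩
  rcases hl.eq_or_lt with rfl | hl'
  · simp
  have e1 : (fun u => l * u) '' Icc (0 : ℝ) 1 = Icc 0 l := by
    rw [Set.image_mul_left_Icc' hl']; simp
  rw [← setLIntegral_congr (Ico_ae_eq_Icc (μ := volume) (a := (0 : ℝ)) (b := l)).symm, ← e1,
    lintegral_image_eq_lintegral_abs_deriv_mul measurableSet_Icc (f' := fun _ => l)
      (fun x _ => by simpa using ((hasDerivAt_id x).const_mul l).hasDerivWithinAt)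
      (fun x _ y _ hxy => mul_left_cancel₀ hl'.ne' hxy),
    lintegral_const_mul' _ _ (by simp), abs_of_pos hl']
  refine le_of_eq ?_
  congr 1
  refine setLIntegral_congr_fun measurableSet_Icc fun t ht => ?_
  simp only [γ, projIcc_of_mem _ ht, ContinuousMap.coe_mk]

end Compactness

/-! ### Limits of discrete paths and the key lower bound on `A`. -/

section Convergence

variable {X : Type*} [MetricSpace X] [CompleteSpace X]

/-- Discrete paths of bounded cost, with one end in `K`, stay in a compact set if the weight is
large off compact sets. -/
theorem isCompact_closure_chains {W : X → ℝ≥0∞} {K : Set X} {T : ℕ → Set X}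
    (hT : ∀ N, IsCompact (T N)) (hKT : ∀ N, K ⊆ T N)
    (hWT : ∀ N x, x ∉ T N → (N : ℝ≥0∞) ≤ W x) {C : ℝ} {m : ℕ → ℕ}
    (hm : Tendsto m atTop atTop) {q : ℕ → ℕ → X} {k : ℕ → ℕ}
    (hq : ∀ n, ∀ i < k n, dist (q n i) (q n (i + 1)) ≤ 1 / ((m n : ℝ) + 1))
    (hends : ∀ n, q n 0 ∈ K ∨ q n (k n) ∈ K)
    (hcost : ∀ n, chainCost (lipApprox W (m n)) (q n) (k n) ≤ C) :
    IsCompact (closure (⋃ n, q n '' Iic (k n))) := by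
  refine isCompact_closure_iUnion (fun n => (finite_Iic _).image _) fun ε hε => ?_
  -- The cost bound will give `N * (D - 2 / N) ≤ C`, that is `D ≤ (C + 2) / N`, and this has to be
  -- below `ε`.
  obtain ⟨N, hN⟩ := exists_nat_gt (max 1 ((C + 2) / ε))
  have hN1 : (1 : ℝ) < N := (le_max_left _ _).trans_lt hN
  have hN0 : (0 : ℝ) < N := by linarith
  have hNε : (C + 2) / N < ε := by
    rw [div_lt_iff₀ hN0, mul_comm, ← div_lt_iff₀ hε]
    exact (le_max_right _ _).trans_lt hN
  -- From `m n ≥ N ^ 2` the approximate weight is at least `N` at distance `1 / N` from `T N`, and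
  -- the steps are at most `1 / N`.
  obtain ⟨n₀, hn₀⟩ := (hm.eventually_ge_atTop (N ^ 2)).exists_forall_of_atTop
  refine ⟨T N, hT N, n₀, fun n hn => ?_⟩
  rintro _ ⟨i, hi, rfl⟩
  have hmN : (N : ℝ) ^ 2 ≤ m n := by exact_mod_cast hn₀ n hn
  have hmN' : (N : ℝ) ≤ m n := by nlinarith
  have hne : (T N).Nonempty := by
    rcases hends n with h | h
    exacts [⟨_, hKT N h⟩, ⟨_, hKT N h⟩]
  set D : X → ℝ := fun x => infDist x (T N) with hD
  have hDK : ∀ x ∈ K, D x ≤ 2 * (1 / N) := fun x hx => by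
    simp only [hD, infDist_zero_of_mem (hKT N hx)]; positivity
  have hDlip : ∀ x y, D x ≤ D y + dist x y := fun x y => infDist_le_infDist_add_dist
  have hw : ∀ x, 1 / (N : ℝ) ≤ D x → (N : ℝ) ≤ lipApprox W (m n) x := fun x hx => by
    refine le_lipApprox (r := 1 / N) hmN' ?_ fun y hy => ?_
    · rw [mul_one_div, le_div_iff₀ hN0]; nlinarith
    · rw [ENNReal.ofReal_natCast]
      refine hWT N y fun hyT => ?_
      exact absurd (hx.trans (infDist_le_dist_of_mem hyT)) (not_le.2 hy)
  have hstep : ∀ i < k n, dist (q n i) (q n (i + 1)) ≤ 1 / N := fun i hi =>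
    (hq n i hi).trans (one_div_le_one_div_of_le hN0 (by linarith))
  have hbound : N * (D (q n i) - 2 * (1 / N)) ≤ C := by
    have hw0 := lipApprox_nonneg W (m n)
    rcases hends n with h | h
    · refine (chainCost_ge_of_start hN0.le hw0 hDlip hw hstep (hDK _ h) i hi).trans
        (le_trans ?_ (hcost n))
      exact Finset.sum_le_sum_of_subset_of_nonneg (Finset.range_mono hi)
        fun _ _ _ => mul_nonneg (hw0 _) dist_nonneg
    · exact (chainCost_ge_of_end hN0.le (by positivity) hw0 hDlip hw (hDK _ h) i hi).trans (hcost n)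
  have hlt : infDist (q n i) (T N) < ε := by
    refine lt_of_le_of_lt ?_ hNε
    rw [le_div_iff₀ hN0]
    have : (N : ℝ) * (2 * (1 / N)) = 2 := by field_simp
    simp only [hD] at hbound
    nlinarith
  obtain ⟨y, hy, hlt'⟩ := (infDist_lt_iff hne).1 hlt
  exact ⟨y, hy, hlt'⟩

variable [MeasurableSpace X] [BorelSpace X]

/-- Discrete paths of bounded cost subconverge to a curve, with a lower semicontinuity estimate. -/
theorem exists_limit_curve {W : X → ℝ≥0∞} (hW : LowerSemicontinuous W) {Q : Set X}
    (hQ : IsCompact Q) {Λ : ℝ} {m : ℕ → ℕ} (hm : Tendsto m atTop atTop) {q : ℕ → ℕ → X} {k : ℕ → ℕ}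
    (hq : ∀ n, ∀ i < k n, dist (q n i) (q n (i + 1)) ≤ 1 / ((m n : ℝ) + 1))
    (hqQ : ∀ n, ∀ i ≤ k n, q n i ∈ Q) (hlen : ∀ n, chainLength (q n) (k n) ≤ Λ) :
    ∃ (φ : ℕ → ℕ) (γ : C(I, X)), StrictMono φ ∧ Rectifiable γ ∧
      Tendsto (fun j => q (φ j) 0) atTop (𝓝 (γ 0)) ∧
      Tendsto (fun j => q (φ j) (k (φ j))) atTop (𝓝 (γ 1)) ∧
      pathIntegral γ W ≤ liminf (fun j => ENNReal.ofReal
        (chainCost (lipApprox W (m (φ j))) (q (φ j)) (k (φ j)))) atTop := by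
  have hδ : Tendsto (fun n => 1 / ((m n : ℝ) + 1)) atTop (𝓝 0) :=
    tendsto_one_div_add_atTop_nhds_zero_nat.comp hm
  have hdist : ∀ n s t, dist (stepCurve (q n) (k n) s) (stepCurve (q n) (k n) t) ≤
      |s - t| + 1 / ((m n : ℝ) + 1) := fun n s t => dist_stepCurve_le (by positivity) (hq n) s t
  obtain ⟨φ, κ, hφ, hκ, hlim⟩ := exists_tendsto_subseq_of_asymptotically_lipschitz hQ
    (c := fun n => stepCurve (q n) (k n)) (fun n s => hqQ n _ (stepIndex_le _ _ _)) hδ hdist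
  obtain ⟨l, hl, ψ, hψ, hψl⟩ := (isCompact_Icc (a := (0 : ℝ)) (b := Λ)).tendsto_subseq
    (x := fun j => chainLength (q (φ j)) (k (φ j))) fun j => ⟨chainLength_nonneg _ _, hlen _⟩
  set θ : ℕ → ℕ := φ ∘ ψ with hθ
  have hθm : StrictMono θ := hφ.comp hψ
  have hlim' : ∀ s, Tendsto (fun j => stepCurve (q (θ j)) (k (θ j)) s) atTop (𝓝 (κ s)) :=
    fun s => (hlim s).comp hψ.tendsto_atTop
  have hmθ : Tendsto (fun j => m (θ j)) atTop atTop := hm.comp hθm.tendsto_atTop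
  obtain ⟨γ, hγ, hγ0, hγ1, hle⟩ := exists_curve_pathIntegral_le hκ hl.1 hW.measurable
  refine ⟨θ, γ, hθm, hγ, ?_, ?_, hle.trans ?_⟩
  · rw [hγ0]
    simpa only [stepCurve_zero] using hlim' 0
  · rw [hγ1]
    refine (hlim' l).congr_dist ?_
    have h0 : Tendsto (fun j => |l - chainLength (q (θ j)) (k (θ j))| + 1 / ((m (θ j) : ℝ) + 1))
        atTop (𝓝 0) := by
      have h1 := ((hψl.const_sub l).abs).add (hδ.comp hθm.tendsto_atTop)
      simpa [hθ] using h1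
    refine squeeze_zero (fun _ => dist_nonneg) (fun j => ?_) h0
    have := hdist (θ j) l (chainLength (q (θ j)) (k (θ j)))
    rwa [stepCurve_chainLength] at this
  -- The costs are integrals of step functions over intervals of varying length. Indicators put them
  -- on the whole line so that Fatou's lemma applies.
  · let G : ℕ → ℝ → ℝ≥0∞ := fun j => (Ico 0 (chainLength (q (θ j)) (k (θ j)))).indicator
      fun s => ENNReal.ofReal (lipApprox W (m (θ j)) (stepCurve (q (θ j)) (k (θ j)) s))
    have hG : ∀ j, Measurable (G j) := fun j => Measurable.indicator
      (measurable_comp_stepCurve (fun x => ENNReal.ofReal (lipApprox W (m (θ j)) x)) _ _)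
      measurableSet_Ico
    have hGint : ∀ j, ∫⁻ s, G j s = ENNReal.ofReal
        (chainCost (lipApprox W (m (θ j))) (q (θ j)) (k (θ j))) := fun j => by
      rw [lintegral_indicator measurableSet_Ico, lintegral_stepCurve (lipApprox_nonneg W _)]
    simp_rw [← hGint]
    refine le_trans ?_ (lintegral_liminf_le hG)
    rw [← lintegral_indicator measurableSet_Ico]
    refine lintegral_mono fun s => ?_
    by_cases hs : s ∈ Ico 0 l
    · rw [indicator_of_mem hs]
      refine (le_liminf_lipApprox hW hmθ (hlim' s)).trans (le_of_eq ?_)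
      refine liminf_congr ?_
      filter_upwards [hψl.eventually_const_lt hs.2] with j hj
      have hmem : s ∈ Ico 0 (chainLength (q (θ j)) (k (θ j))) := ⟨hs.1, hj⟩
      simp only [G]
      rw [indicator_of_mem hmem]
    · rw [indicator_of_notMem hs]
      exact zero_le

/-- The discrete extensions of `f|_A` are uniformly close to `f` on `A` at small scales. -/
theorem exists_forall_sub_le_chainExtension {W : X → ℝ≥0∞} (hW : LowerSemicontinuous W) {η : ℝ}
    (hη : 0 < η) (hWη : ∀ x, ENNReal.ofReal η ≤ W x) {A K : Set X} {T : ℕ → Set X}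
    (hT : ∀ N, IsCompact (T N)) (hKT : ∀ N, K ⊆ T N)
    (hWT : ∀ N x, x ∉ T N → (N : ℝ≥0∞) ≤ W x) (hA : IsClosed A) {f : X → ℝ} {M : ℝ}
    (hf : ∀ x, |f x| ≤ M) (hfA : ContinuousOn f A) (hf0 : ∀ x ∈ A, x ∉ K → f x = 0)
    (hfW : ∀ γ : C(I, X), Rectifiable γ →
      ENNReal.ofReal |f (γ 1) - f (γ 0)| ≤ pathIntegral γ W) {δ : ℝ} (hδ : 0 < δ) :
    ∃ n : ℕ, ∀ x ∈ A, f x - δ ≤ chainExtension A f (lipApprox W n) M (1 / ((n : ℝ) + 1)) x := by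
  by_contra! hcon
  -- The shift by `n₁` ensures `m n ≥ η`, so that the approximate weights inherit the lower bound
  -- `η` of `W`.
  obtain ⟨n₁, hn₁⟩ := exists_nat_ge η
  set m : ℕ → ℕ := fun n => n + n₁ with hmdef
  have hm : Tendsto m atTop atTop := tendsto_add_atTop_nat n₁
  choose x hxA hx using fun n => hcon (m n)
  -- As `f (x n) - δ ≤ M`, the truncation level cannot account for the small value, so a discrete
  -- path does.
  choose q k hqA hqk hq hcost using fun n => exists_chain_of_chainExtension_lt (hx n)
    (by linarith [(abs_le.1 (hf (x n))).2])
  have hc0 : ∀ n, 0 ≤ chainCost (lipApprox W (m n)) (q n) (k n) := fun n =>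
    chainCost_nonneg (lipApprox_nonneg W _) _ _
  have hcM : ∀ n, chainCost (lipApprox W (m n)) (q n) (k n) ≤ 2 * M := fun n => by
    linarith [hcost n, (abs_le.1 (hf (x n))).2, (abs_le.1 (hf (q n 0))).1]
  -- If both ends were off `K`, then `f` would vanish at both and the cost would be below `-δ`.
  have hends : ∀ n, q n 0 ∈ K ∨ q n (k n) ∈ K := by
    intro n
    by_contra! hno
    rw [hqk] at hno
    have h1 := hcost n
    rw [hf0 _ (hqA n) hno.1, hf0 _ (hxA n) hno.2] at h1
    linarith [hc0 n]
  have hQ := isCompact_closure_chains hT hKT hWT hm hq hends hcM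
  have hlen : ∀ n, chainLength (q n) (k n) ≤ 2 * M / η := fun n => by
    rw [le_div_iff₀ hη, mul_comm, chainLength, Finset.mul_sum]
    refine le_trans (Finset.sum_le_sum fun i _ => ?_) (hcM n)
    gcongr
    have h1 : (n₁ : ℝ) ≤ m n := by simp [hmdef]
    exact le_lipApprox (r := 1) (by linarith) (by linarith) fun y _ => hWη y
  obtain ⟨φ, γ, hφ, hγ, hγ0, hγ1, hint⟩ := exists_limit_curve hW hQ hm hq
    (fun n i hi => subset_closure (mem_iUnion.2 ⟨n, i, hi, rfl⟩)) hlen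
  simp_rw [hqk] at hγ1
  have hy0 : γ 0 ∈ A := hA.mem_of_tendsto hγ0 (Eventually.of_forall fun j => hqA _)
  have hy1 : γ 1 ∈ A := hA.mem_of_tendsto hγ1 (Eventually.of_forall fun j => hxA _)
  have hf0' : Tendsto (fun j => f (q (φ j) 0)) atTop (𝓝 (f (γ 0))) :=
    (hfA _ hy0).tendsto.comp (tendsto_nhdsWithin_iff.2 ⟨hγ0, Eventually.of_forall fun j => hqA _⟩)
  have hf1' : Tendsto (fun j => f (x (φ j))) atTop (𝓝 (f (γ 1))) :=
    (hfA _ hy1).tendsto.comp (tendsto_nhdsWithin_iff.2 ⟨hγ1, Eventually.of_forall fun j => hxA _⟩)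
  have hlim := (hf1'.sub hf0').sub_const δ
  -- Nonnegativity is needed because `ENNReal.ofReal` sends negative numbers to `0`, which would
  -- hide the loss of `δ`.
  have h1 : 0 ≤ f (γ 1) - f (γ 0) - δ :=
    ge_of_tendsto' hlim fun j => by linarith [hcost (φ j), hc0 (φ j)]
  have h2 : pathIntegral γ W ≤ ENNReal.ofReal (f (γ 1) - f (γ 0) - δ) := by
    refine hint.trans ?_
    rw [← (ENNReal.tendsto_ofReal hlim).liminf_eq]
    refine liminf_le_liminf (Eventually.of_forall fun j => ENNReal.ofReal_le_ofReal ?_)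
    linarith [hcost (φ j)]
  have h3 := (ENNReal.ofReal_le_ofReal_iff h1).1 ((hfW γ hγ).trans h2)
  linarith [le_abs_self (f (γ 1) - f (γ 0))]

end Convergence

/-! ### Exact boundary values by clamping, and cutting off the upper gradient. -/

section UniformLimit

variable {X : Type*} [MetricSpace X]

/-- Maximum and minimum are 1-Lipschitz in the sup norm. Hence clamping one function to a band
around another keeps a common upper gradient, with no constant lost. -/
theorem abs_clamp_sub_clamp_le (a a' c c' δ : ℝ) :
    |max (a - δ) (min (a + δ) c) - max (a' - δ) (min (a' + δ) c')| ≤ max |a - a'| |c - c'| := by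
  refine (abs_max_sub_max_le_max _ _ _ _).trans (max_le ?_ ?_)
  · rw [sub_sub_sub_cancel_right]
    exact le_max_left _ _
  · refine (abs_min_sub_min_le_max _ _ _ _).trans ?_
    rw [add_sub_add_right_eq_sub]

/-- If `f` is on `A` a uniform limit of continuous functions with upper gradient `W`, then `f|_A`
extends to a continuous function with upper gradient `W`. -/
theorem exists_continuous_eqOn_of_uniform_approx {W : X → ℝ≥0∞} {A : Set X} {f : X → ℝ} {M : ℝ}
    (h : ∀ δ > 0, ∃ u : X → ℝ, Continuous u ∧ (∀ x, |u x| ≤ M) ∧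
      (∀ γ : C(I, X), Rectifiable γ → ENNReal.ofReal |u (γ 1) - u (γ 0)| ≤ pathIntegral γ W) ∧
      ∀ x ∈ A, |u x - f x| ≤ δ) :
    ∃ u : X → ℝ, Continuous u ∧ (∀ x, |u x| ≤ M) ∧
      (∀ γ : C(I, X), Rectifiable γ → ENNReal.ofReal |u (γ 1) - u (γ 0)| ≤ pathIntegral γ W) ∧
      EqOn u f A := by
  choose u huc huM huW huf using fun n : ℕ => h ((1 / 2) ^ n) (by positivity)
  -- Each `v (n + 1)` is `u (n + 1)` clamped to the band of radius `(1 / 2) ^ n` around `v n`. This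
  -- forces uniform convergence on all of `X`. On `A` the value of `f` lies in the band, so clamping
  -- does not spoil the approximation there.
  let v : ℕ → X → ℝ := fun n => Nat.rec (u 0) (fun n w x =>
    max (w x - (1 / 2) ^ n) (min (w x + (1 / 2) ^ n) (u (n + 1) x))) n
  have hv : ∀ n x, v (n + 1) x =
    max (v n x - (1 / 2) ^ n) (min (v n x + (1 / 2) ^ n) (u (n + 1) x)) := fun _ _ => rfl
  have hvc : ∀ n, Continuous (v n) := fun n => by
    induction n with
    | zero => exact huc 0
    | succ n ih =>
      have := huc (n + 1)
      rw [show v (n + 1) = _ from funext (hv n)]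
      fun_prop
  have hpow : ∀ n : ℕ, (0 : ℝ) < (1 / 2) ^ n := fun n => by positivity
  have hvM : ∀ n x, |v n x| ≤ M := fun n x => by
    induction n with
    | zero => exact huM 0 x
    | succ n ih =>
      have h1 := abs_le.1 ih
      have h2 := abs_le.1 (huM (n + 1) x)
      have h3 := hpow n
      rw [hv, abs_le]
      refine ⟨le_max_of_le_right (le_min (by linarith) h2.1), max_le (by linarith) ?_⟩
      exact (min_le_right _ _).trans h2.2
  have hvW : ∀ n (γ : C(I, X)), Rectifiable γ →
      ENNReal.ofReal |v n (γ 1) - v n (γ 0)| ≤ pathIntegral γ W := fun n γ hγ => by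
    induction n with
    | zero => exact huW 0 γ hγ
    | succ n ih =>
      rw [hv, hv]
      refine (ENNReal.ofReal_le_ofReal (abs_clamp_sub_clamp_le _ _ _ _ _)).trans ?_
      rw [ENNReal.ofReal_max]
      exact max_le ih (huW (n + 1) γ hγ)
  have hvf : ∀ n, ∀ x ∈ A, |v n x - f x| ≤ (1 / 2) ^ n := fun n x hx => by
    induction n with
    | zero => exact huf 0 x hx
    | succ n ih =>
      have h1 := abs_le.1 ih
      have h2 := abs_le.1 (huf (n + 1) x hx)
      have h3 := hpow (n + 1)
      rw [hv, abs_le]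
      constructor
      · rw [neg_le_sub_iff_le_add, ← sub_le_iff_le_add]
        exact le_max_of_le_right (le_min (by linarith) (by linarith))
      · rw [sub_le_iff_le_add]
        exact max_le (by linarith) ((min_le_right _ _).trans (by linarith))
  have hvd : ∀ x n, dist (v n x) (v (n + 1) x) ≤ 1 * (1 / 2) ^ n := fun x n => by
    have h3 := hpow n
    rw [one_mul, dist_comm, Real.dist_eq, hv, abs_le]
    constructor
    · rw [neg_le_sub_iff_le_add, ← sub_le_iff_le_add]
      exact le_max_left _ _
    · rw [sub_le_iff_le_add, add_comm]
      exact max_le (by linarith) (min_le_left _ _)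
  have hlim : ∀ x, ∃ y, Tendsto (fun n => v n x) atTop (𝓝 y) := fun x =>
    cauchySeq_tendsto_of_complete (cauchySeq_of_le_geometric _ _ (by norm_num) (hvd x))
  choose F hF using hlim
  have hpow0 : Tendsto (fun n : ℕ => 1 * (1 / 2 : ℝ) ^ n / (1 - 1 / 2)) atTop (𝓝 0) := by
    have := ((tendsto_pow_atTop_nhds_zero_of_lt_one (r := (1 / 2 : ℝ)) (by norm_num)
      (by norm_num)).const_mul 1).div_const (1 - 1 / 2)
    simpa using this
  refine ⟨F, ?_, fun x => ?_, fun γ hγ => ?_, fun x hx => ?_⟩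
  · have hunif : TendstoUniformly v F atTop := by
      rw [Metric.tendstoUniformly_iff]
      intro ε hε
      filter_upwards [hpow0.eventually_lt_const hε] with n hn x
      rw [dist_comm]
      exact (dist_le_of_le_geometric_of_tendsto _ _ (by norm_num) (hvd x) (hF x) n).trans_lt hn
    exact hunif.continuous (Frequently.of_forall hvc)
  · exact le_of_tendsto' (hF x).abs fun n => hvM n x
  · exact le_of_tendsto' (ENNReal.tendsto_ofReal ((hF _).sub (hF _)).abs) fun n => hvW n γ hγ
  · have h1 : Tendsto (fun n : ℕ => (1 / 2 : ℝ) ^ n) atTop (𝓝 0) :=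
      tendsto_pow_atTop_nhds_zero_of_lt_one (by norm_num) (by norm_num)
    have h2 := le_of_tendsto_of_tendsto' ((hF x).sub_const (f x)).abs h1 fun n => hvf n x hx
    exact sub_eq_zero.1 (abs_nonpos_iff.1 h2)

/-- An upper gradient of a function that vanishes off an open set may be cut off there. -/
theorem ofReal_abs_sub_le_pathIntegral_indicator {W : X → ℝ≥0∞} {B : Set X} (hB : IsOpen B)
    {F : X → ℝ} (hF0 : ∀ x, x ∉ B → F x = 0)
    (hF : ∀ γ : C(I, X), Rectifiable γ → ENNReal.ofReal |F (γ 1) - F (γ 0)| ≤ pathIntegral γ W)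
    {γ : C(I, X)} (hγ : Rectifiable γ) :
    ENNReal.ofReal |F (γ 1) - F (γ 0)| ≤ pathIntegral γ (B.indicator W) := by
  have hpc := (lipschitzWith_param hγ).continuous
  have hsub : ∀ a b, 0 ≤ a → a ≤ b → b ≤ 1 →
      ENNReal.ofReal |F (param γ b) - F (param γ a)| ≤
        curveLength γ * ∫⁻ t in Icc a b, W (param γ t) := by
    intro a b ha hab hb
    rcases hab.eq_or_lt with rfl | hab'
    · simp
    obtain ⟨τ, hτ, h0, h1, hint⟩ := exists_subcurve hγ ha hab' hb
    rw [← hint, ← h0, ← h1]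
    exact hF τ hτ
  -- `Z` is the set of times spent off `B`. Only the parts before its first and after its last time
  -- matter: `F` vanishes at both, so the middle part can be dropped.
  let Z : Set ℝ := {t | t ∈ Icc (0 : ℝ) 1 ∧ param γ t ∉ B}
  have hZc : IsCompact Z :=
    isCompact_Icc.inter_right (hB.isClosed_compl.preimage hpc)
  rcases Z.eq_empty_or_nonempty with hZ | hZ
  · refine (hF γ hγ).trans (le_of_eq ?_)
    rw [pathIntegral_eq_param, pathIntegral_eq_param]
    congr 1
    refine setLIntegral_congr_fun measurableSet_Icc fun t ht => ?_
    have : param γ t ∈ B := by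
      by_contra hcon
      exact (hZ ▸ (⟨ht, hcon⟩ : t ∈ Z) : t ∈ (∅ : Set ℝ))
    simp only [indicator_of_mem this]
  · obtain ⟨⟨ha0, ha1⟩, haB⟩ := hZc.sInf_mem hZ
    obtain ⟨⟨hb0, hb1⟩, hbB⟩ := hZc.sSup_mem hZ
    set a := sInf Z
    set b := sSup Z
    have hab : a ≤ b := le_csSup hZc.bddAbove (hZc.sInf_mem hZ)
    have h1 := hsub 0 a le_rfl ha0 ha1
    have h2 := hsub b 1 hb0 hb1 le_rfl
    rw [hF0 _ haB, param_zero hγ] at h1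
    rw [hF0 _ hbB, param_one hγ] at h2
    have e1 : ∫⁻ t in Icc 0 a, W (param γ t) = ∫⁻ t in Ico 0 a, B.indicator W (param γ t) := by
      rw [← setLIntegral_congr Ico_ae_eq_Icc]
      refine setLIntegral_congr_fun measurableSet_Ico fun t ht => ?_
      have : param γ t ∈ B := by
        by_contra hcon
        exact absurd (csInf_le hZc.bddBelow ⟨⟨ht.1, ht.2.le.trans ha1⟩, hcon⟩) (not_le.2 ht.2)
      simp only [indicator_of_mem this]
    have e2 : ∫⁻ t in Icc b 1, W (param γ t) = ∫⁻ t in Ioc b 1, B.indicator W (param γ t) := by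
      rw [← setLIntegral_congr Ioc_ae_eq_Icc]
      refine setLIntegral_congr_fun measurableSet_Ioc fun t ht => ?_
      have : param γ t ∈ B := by
        by_contra hcon
        exact absurd (le_csSup hZc.bddAbove ⟨⟨hb0.trans ht.1.le, ht.2⟩, hcon⟩) (not_le.2 ht.1)
      simp only [indicator_of_mem this]
    rw [e1] at h1
    rw [e2] at h2
    have h3 : |F (γ 1) - F (γ 0)| ≤ |0 - F (γ 0)| + |F (γ 1) - 0| := by
      refine (le_of_eq ?_).trans (abs_add_le _ _)
      congr 1
      ring
    refine (ENNReal.ofReal_le_ofReal h3).trans ?_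
    rw [ENNReal.ofReal_add (abs_nonneg _) (abs_nonneg _), pathIntegral_eq_param]
    refine (add_le_add h1 h2).trans ?_
    rw [← mul_add]
    gcongr
    have hdisj : Disjoint (Ico 0 a) (Ioc b 1) :=
      Set.disjoint_left.2 fun t ht ht' => absurd (hab.trans_lt ht'.1) (not_lt.2 ht.2.le)
    rw [← lintegral_union measurableSet_Ioc hdisj]
    refine lintegral_mono_set (union_subset (fun t ht => ⟨ht.1, ht.2.le.trans ha1⟩)
      fun t ht => ⟨hb0.trans ht.1.le, ht.2⟩)

end UniformLimit

/-! ### Construction of the weight `W`. -/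

section Weight

variable {X : Type*} [MetricSpace X] [CompleteSpace X] [SecondCountableTopology X]
  [MeasurableSpace X] [BorelSpace X]

/-- A lower semicontinuous majorant of `g`, bounded from below and large off compact sets, whose
`p`-energy on `B` is almost that of `g`. -/
theorem exists_lowerSemicontinuous_weight {ν : Measure X} [IsFiniteMeasure ν] {p : ℝ} (hp : 0 < p)
    {g : X → ℝ≥0∞} (hg : Measurable g) {K : Set X} (hK : IsCompact K) {ε : ℝ≥0∞} (hε : ε ≠ 0) :
    ∃ W : X → ℝ≥0∞, LowerSemicontinuous W ∧ (∀ x, g x ≤ W x) ∧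
      (∃ η : ℝ, 0 < η ∧ ∀ x, ENNReal.ofReal η ≤ W x) ∧
      (∃ T : ℕ → Set X, (∀ N, IsCompact (T N)) ∧ (∀ N, K ⊆ T N) ∧
        ∀ N x, x ∉ T N → (N : ℝ≥0∞) ≤ W x) ∧
      ∫⁻ x, W x ^ p ∂ν ≤ ∫⁻ x, g x ^ p ∂ν + ε := by
  have hε3 : ε / 3 ≠ 0 := by simp [hε]
  obtain ⟨h, hgh, hh, hhint⟩ := exists_le_lowerSemicontinuous_lintegral_ge ν (fun x => g x ^ p)
    (hg.pow_const p) hε3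
  obtain ⟨c, hc0, hc⟩ : ∃ c : ℝ≥0, 0 < c ∧ (c : ℝ≥0∞) * ν univ < ε / 3 := by
    obtain ⟨c, hc0, hc⟩ := ENNReal.exists_nnreal_pos_mul_lt (measure_ne_top ν univ) hε3
    exact ⟨c, hc0, hc⟩
  obtain ⟨δ, hδ, hδsum⟩ := ENNReal.exists_pos_sum_of_countable' hε3 ℕ
  have hNtop : ∀ N : ℕ, (N : ℝ≥0∞) ^ p ≠ ∞ := fun N =>
    ENNReal.rpow_ne_top_of_nonneg hp.le (ENNReal.natCast_ne_top N)
  have hT : ∀ N : ℕ, ∃ T : Set X, IsCompact T ∧ ν Tᶜ ≤ ((N : ℝ≥0∞) ^ p + 1)⁻¹ * δ N := by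
    intro N
    -- The summand `1` keeps the factor invertible for `N = 0`. The value `N ^ p` off `T N` then
    -- costs at most `δ N`.
    have hpos : 0 < ((N : ℝ≥0∞) ^ p + 1)⁻¹ * δ N :=
      ENNReal.mul_pos (by simpa using hNtop N) (hδ N).ne'
    obtain ⟨T, hT, hle⟩ := isTightMeasureSet_iff_exists_isCompact_measure_compl_le.1
      (isTightMeasureSet_singleton (μ := ν)) _ hpos
    exact ⟨T, hT, hle ν rfl⟩
  choose T hTc hTν using hT
  let S : ℕ → Set X := fun N => T N ∪ K
  have hS : ∀ N, IsCompact (S N) := fun N => (hTc N).union hK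
  let k : ℕ → X → ℝ≥0∞ := fun N => (S N)ᶜ.indicator fun _ => (N : ℝ≥0∞) ^ p
  -- `V` is `W ^ p`. The constant `c`, the majorant `h` of `g ^ p` and the functions `k N` each
  -- exceed the budget by at most `ε / 3`, the last ones in total.
  let V : X → ℝ≥0∞ := fun x => max (max (c : ℝ≥0∞) (h x)) (⨆ N, k N x)
  have hV : LowerSemicontinuous V := by
    refine (lowerSemicontinuous_const.sup hh).sup (lowerSemicontinuous_iSup fun N => ?_)
    exact (hS N).isClosed.isOpen_compl.lowerSemicontinuous_indicator (by simp)
  refine ⟨fun x => V x ^ p⁻¹, ?_, fun x => ?_, ⟨((c : ℝ≥0∞) ^ p⁻¹).toReal, ?_, fun x => ?_⟩,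
    ⟨S, hS, fun N => subset_union_right, fun N x hx => ?_⟩, ?_⟩
  · exact ENNReal.continuous_rpow_const.comp_lowerSemicontinuous hV
      (ENNReal.monotone_rpow_of_nonneg (by positivity))
  · rw [ENNReal.le_rpow_inv_iff hp]
    exact (hgh x).trans ((le_max_right _ _).trans (le_max_left _ _))
  · refine ENNReal.toReal_pos ?_ ?_
    · simp [hc0.ne', hp]
    · exact ENNReal.rpow_ne_top_of_nonneg (by positivity) ENNReal.coe_ne_top
  · rw [ENNReal.ofReal_toReal (ENNReal.rpow_ne_top_of_nonneg (by positivity) ENNReal.coe_ne_top)]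
    exact ENNReal.rpow_le_rpow ((le_max_left _ _).trans (le_max_left _ _)) (by positivity)
  · rw [ENNReal.le_rpow_inv_iff hp]
    refine le_trans ?_ (le_max_right _ _)
    refine le_trans ?_ (le_iSup _ N)
    simp only [k]
    rw [indicator_of_mem (mem_compl hx)]
  · have hk : ∀ N, ∫⁻ x, k N x ∂ν ≤ δ N := by
      intro N
      simp only [k]
      rw [lintegral_indicator_const (hS N).isClosed.measurableSet.compl]
      have h1 : ν (S N)ᶜ ≤ ((N : ℝ≥0∞) ^ p + 1)⁻¹ * δ N :=
        (measure_mono (compl_subset_compl.2 subset_union_left)).trans (hTν N)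
      calc (N : ℝ≥0∞) ^ p * ν (S N)ᶜ
          ≤ ((N : ℝ≥0∞) ^ p + 1) * (((N : ℝ≥0∞) ^ p + 1)⁻¹ * δ N) := by
            gcongr
            exact le_self_add
        _ = δ N := by
            rw [← mul_assoc, ENNReal.mul_inv_cancel (by simp) (by simpa using hNtop N), one_mul]
    calc ∫⁻ x, (V x ^ p⁻¹) ^ p ∂ν ≤ ∫⁻ x, ((c : ℝ≥0∞) + h x + ∑' N, k N x) ∂ν := by
          refine lintegral_mono fun x => ?_
          rw [ENNReal.rpow_inv_rpow hp.ne']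
          refine max_le ((max_le le_self_add le_add_self).trans le_self_add) (le_trans ?_ le_add_self)
          exact iSup_le fun N => ENNReal.le_tsum N
      _ = (c : ℝ≥0∞) * ν univ + ∫⁻ x, h x ∂ν + ∑' N, ∫⁻ x, k N x ∂ν := by
          have hkm : ∀ N, Measurable (k N) := fun N =>
            measurable_const.indicator (hS N).isClosed.measurableSet.compl
          rw [lintegral_add_right _ (Measurable.tsum hkm), lintegral_add_left measurable_const,
            lintegral_const, lintegral_tsum fun N => (hkm N).aemeasurable]
      _ ≤ ε / 3 + (∫⁻ x, g x ^ p ∂ν + ε / 3) + ε / 3 := by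
          gcongr
          exact (ENNReal.tsum_le_tsum hk).trans hδsum.le
      _ = ∫⁻ x, g x ^ p ∂ν + ε := by
          rw [add_comm (ε / 3), add_assoc, add_assoc, ← add_assoc (ε / 3), ENNReal.add_thirds]

end Weight

/-! ### Truncation of extended real values. -/

section Truncation

/-- Truncation of an extended real at the levels `±M`. -/
def truncate (M : ℝ) (a : EReal) : ℝ := (max (-M : EReal) (min M a)).toReal

theorem truncate_coe {M : ℝ} (r : ℝ) : truncate M r = max (-M) (min M r) := by
  have hm := EReal.coe_strictMono.monotone
  rw [truncate, ← hm.map_min, ← EReal.coe_neg, ← hm.map_max, EReal.toReal_coe]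

theorem truncate_coe_of_abs_le {M r : ℝ} (h : |r| ≤ M) : truncate M r = r := by
  rw [truncate_coe, min_eq_right (abs_le.1 h).2, max_eq_right (abs_le.1 h).1]

theorem abs_truncate_le {M : ℝ} (hM : 0 ≤ M) (a : EReal) : |truncate M a| ≤ M := by
  induction a with
  | bot => simp [truncate, hM, abs_of_nonneg]
  | top =>
    have : (-M : EReal) ≤ M := by exact_mod_cast neg_le_self hM
    simp [truncate, this, abs_of_nonneg hM]
  | coe r =>
    rw [truncate_coe, abs_le]
    exact ⟨le_max_left _ _, max_le (neg_le_self hM) (min_le_left _ _)⟩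

/-- Between finite values truncation is a contraction. As soon as one value is infinite, the
convention makes `gap` infinite. -/
theorem ofReal_abs_truncate_sub_le_gap (M : ℝ) (a b : EReal) :
    ENNReal.ofReal |truncate M a - truncate M b| ≤ gap a b := by
  induction a with
  | bot => induction b <;> simp [gap]
  | top => induction b <;> simp [gap]
  | coe r =>
    induction b with
    | bot => simp [gap]
    | top => simp [gap]
    | coe s =>
      rw [gap_coe, truncate_coe, truncate_coe]
      refine ENNReal.ofReal_le_ofReal ((abs_max_sub_max_le_max _ _ _ _).trans ?_)
      refine max_le (by simp) ((abs_min_sub_min_le_max _ _ _ _).trans (by simp))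

end Truncation

/-! ### The continuous extension with upper gradient supported in `B`. -/

section Extension

variable {X : Type*} [MetricSpace X] [CompleteSpace X] [MeasurableSpace X] [BorelSpace X]

/-- A bounded function with a good upper gradient `W` that is continuous on `K` and vanishes off the
open set `B ⊇ K` can be replaced by a continuous one with the same values on `K` and off `B`. -/
theorem exists_continuous_extension {W : X → ℝ≥0∞} (hW : LowerSemicontinuous W) {η : ℝ}
    (hη : 0 < η) (hWη : ∀ x, ENNReal.ofReal η ≤ W x) {B K : Set X} {T : ℕ → Set X}
    (hT : ∀ N, IsCompact (T N)) (hKT : ∀ N, K ⊆ T N)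
    (hWT : ∀ N x, x ∉ T N → (N : ℝ≥0∞) ≤ W x) (hB : IsOpen B) (hK : IsCompact K)
    {f : X → ℝ} {M : ℝ} (hf : ∀ x, |f x| ≤ M) (hfK : ContinuousOn f K)
    (hf0 : ∀ x, x ∉ B → f x = 0)
    (hfW : ∀ γ : C(I, X), Rectifiable γ →
      ENNReal.ofReal |f (γ 1) - f (γ 0)| ≤ pathIntegral γ W) :
    ∃ F : X → ℝ, Continuous F ∧ (∀ x, |F x| ≤ M) ∧ EqOn F f (K ∪ Bᶜ) ∧
      ∀ γ : C(I, X), Rectifiable γ →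
        ENNReal.ofReal |F (γ 1) - F (γ 0)| ≤ pathIntegral γ (B.indicator W) := by
  have hfB : ContinuousOn f Bᶜ := continuousOn_const.congr hf0
  have hA : IsClosed (K ∪ Bᶜ) := hK.isClosed.union hB.isClosed_compl
  have hfA : ContinuousOn f (K ∪ Bᶜ) := hfK.union_of_isClosed hfB hK.isClosed hB.isClosed_compl
  obtain ⟨F, hFc, hFM, hFW, hFf⟩ := exists_continuous_eqOn_of_uniform_approx (W := W)
    (A := K ∪ Bᶜ) (f := f) (M := M) fun δ hδ => by
      obtain ⟨n, hn⟩ := exists_forall_sub_le_chainExtension hW hη hWη hT hKT hWT hA hf hfA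
        (fun x hx hxK => hf0 x (hx.resolve_left hxK)) hfW hδ
      have hw := (lipschitzWith_lipApprox W n).continuous
      have hw0 := lipApprox_nonneg W n
      have hpos : 0 < 1 / ((n : ℝ) + 1) := by positivity
      have hslope := fun x z => abs_chainExtension_sub_le (A := K ∪ Bᶜ)
        (δ := 1 / ((n : ℝ) + 1)) hf hw0 (x := x) (z := z)
      have hcont := continuous_of_abs_sub_le hw hpos hslope
      refine ⟨_, hcont, abs_chainExtension_le hf hw0, fun γ hγ => ?_, fun x hx => ?_⟩
      · exact (ofReal_abs_sub_le_pathIntegral hcont hw hpos hw0 hslope hγ).trans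
          (pathIntegral_mono γ fun x => ofReal_lipApprox_le W n x)
      · have h1 := chainExtension_le_self (δ := 1 / ((n : ℝ) + 1)) hf hw0 hx
        exact abs_le.2 ⟨by linarith [hn x hx], by linarith⟩
  refine ⟨F, hFc, hFM, hFf, fun γ hγ => ofReal_abs_sub_le_pathIntegral_indicator hB
    (fun x hx => ?_) hFW hγ⟩
  rw [hFf (Or.inr hx), hf0 x hx]

end Extension

end Newtonian

end

/-! ### Assembly of the main theorem. -/

theorem mainTheorem5 {X : Type*} [MetricSpace X] [CompleteSpace X]
    [TopologicalSpace.SeparableSpace X] [MeasurableSpace X] [BorelSpace X]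
    (μ : Measure X) (hμ : ∀ (x : X) (r : ℝ), 0 < r → 0 < μ (ball x r) ∧ μ (ball x r) < ∞)
    (p : ℝ) (hp : 1 ≤ p)
    (f : X → EReal) (hf : Newtonian.InNewtonian p μ f)
    (gstar : X → ℝ≥0∞) (hg : Newtonian.IsUpperGradient gstar f)
    (hgp : ∫⁻ x, gstar x ^ p ∂μ < ∞)
    (x₀ : X) (R : ℝ) (hR : 0 < R) (hf0 : ∀ x, x ∉ ball x₀ R → f x = 0)
    (K : Set X) (hK : IsCompact K) (hKB : K ⊆ ball x₀ R)
    (hfK : ∀ x ∈ K, f x ≠ ⊤ ∧ f x ≠ ⊥) (hfc : ContinuousOn f K)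
    (hgK : ∃ S : ℝ≥0∞, S < ∞ ∧ ∀ x ∈ K, gstar x ≤ S)
    (ε : ℝ) (hε : 0 < ε) :
    ∃ F : X → ℝ,
      (⨆ x, ENNReal.ofReal |F x|) ≤ (⨆ x ∈ K, (f x).abs) ∧
      (∀ x ∈ K, (F x : EReal) = f x) ∧
      (∀ x, x ∉ ball x₀ R → F x = 0) ∧
      Newtonian.InNewtonian p μ (fun x => (F x : EReal)) ∧
      Continuous F ∧
      ∃ gF : X → ℝ≥0∞,
        Newtonian.IsMinimalWeakUpperGradient p μ gF (fun x => (F x : EReal)) ∧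
        ∫⁻ x in Kᶜ, gF x ^ p ∂μ ≤ ∫⁻ x in Kᶜ, gstar x ^ p ∂μ + ENNReal.ofReal ε := by
  have hp0 : 0 < p := by linarith
  have : SecondCountableTopology X := UniformSpace.secondCountable_of_separable X
  set B := ball x₀ R with hBdef
  have hB : IsOpen B := isOpen_ball
  have hμB : μ B < ∞ := (hμ x₀ R hR).2
  have hfin : IsFiniteMeasure (μ.restrict B) := ⟨by simpa using hμB⟩
  have hreal : ∀ x ∈ K, ((f x).toReal : EReal) = f x := fun x hx =>
    EReal.coe_toReal (hfK x hx).1 (hfK x hx).2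
  have habs : ∀ x ∈ K, (f x).abs = ENNReal.ofReal |(f x).toReal| := fun x hx => by
    rw [← EReal.abs_def, hreal x hx]
  have hfKc : ContinuousOn (fun x => (f x).toReal) K :=
    EReal.continuousOn_toReal.comp hfc fun x hx => by simp [hfK x hx]
  obtain ⟨C, hC⟩ := hK.exists_bound_of_continuousOn hfKc
  set m₀ : ℝ≥0∞ := ⨆ x ∈ K, (f x).abs with hm₀
  have hMtop : m₀ ≠ ∞ := by
    refine ne_top_of_le_ne_top (ENNReal.ofReal_ne_top (r := C)) (iSup₂_le fun x hx => ?_)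
    rw [habs x hx]
    exact ENNReal.ofReal_le_ofReal (hC x hx)
  set M : ℝ := m₀.toReal
  have hM0 : 0 ≤ M := ENNReal.toReal_nonneg
  have hfM : ∀ x ∈ K, |(f x).toReal| ≤ M := fun x hx => by
    refine (ENNReal.ofReal_le_iff_le_toReal hMtop).1 ?_
    rw [← habs x hx]
    exact le_iSup₂ (f := fun x _ => (f x).abs) x hx
  have hu : ∀ x ∈ K, Newtonian.truncate M (f x) = (f x).toReal := fun x hx => by
    rw [← hreal x hx, Newtonian.truncate_coe_of_abs_le (hfM x hx), EReal.toReal_coe]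
  -- The weight is built for `μ.restrict B`, which is finite. Its energy outside `B` is uncontrolled
  -- and is removed by the indicator.
  obtain ⟨W, hW, hgW, ⟨η, hη, hWη⟩, ⟨T, hT, hKT, hWT⟩, hWint⟩ :=
    Newtonian.exists_lowerSemicontinuous_weight (ν := μ.restrict B) hp0 hg.1 hK
      (ENNReal.ofReal_pos.2 hε).ne'
  obtain ⟨F, hFc, hFM, hFf, hFW⟩ := Newtonian.exists_continuous_extension hW hη hWη hT hKT hWT hB hK
    (f := fun x => Newtonian.truncate M (f x)) (fun x => Newtonian.abs_truncate_le hM0 _)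
    (hfKc.congr hu) (fun x hx => by
      rw [hf0 x hx, ← EReal.coe_zero, Newtonian.truncate_coe_of_abs_le (by simpa using hM0)])
    (fun γ hγ => by
      by_cases hc : Newtonian.Nonconstant γ
      · exact (Newtonian.ofReal_abs_truncate_sub_le_gap M _ _).trans
          ((hg.2 γ hγ hc).trans (Newtonian.pathIntegral_mono γ hgW))
      · simp only [Newtonian.Nonconstant, not_exists, not_not] at hc
        rw [hc 1 0]
        simp)
  have hF0 : ∀ x, x ∉ B → F x = 0 := fun x hx => by
    rw [hFf (Or.inr hx)]
    simp only
    rw [hf0 x hx, ← EReal.coe_zero, Newtonian.truncate_coe_of_abs_le (by simpa using hM0)]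
  have hug : Newtonian.IsUpperGradient (B.indicator W) (fun x => (F x : EReal)) := by
    refine ⟨hW.measurable.indicator hB.measurableSet, fun γ hγ _ => ?_⟩
    rw [Newtonian.UpperGradientInequality, Newtonian.gap_coe]
    exact hFW γ hγ
  have hind : ∀ E : Set X, MeasurableSet E →
      ∫⁻ x in E, B.indicator W x ^ p ∂μ = ∫⁻ x in E, W x ^ p ∂(μ.restrict B) := by
    intro E hE
    have : (fun x => B.indicator W x ^ p) = B.indicator fun x => W x ^ p := by
      ext x
      by_cases hx : x ∈ B <;> simp [hx, hp0]
    rw [this, lintegral_indicator hB.measurableSet, Measure.restrict_restrict hE,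
      Measure.restrict_restrict hB.measurableSet, inter_comm]
  have hgB : ∫⁻ x in B, gstar x ^ p ∂μ < ∞ := (setLIntegral_le_lintegral _ _).trans_lt hgp
  have hindfin : ∫⁻ x, B.indicator W x ^ p ∂μ < ∞ := by
    have := hind univ MeasurableSet.univ
    rw [Measure.restrict_univ, Measure.restrict_univ] at this
    rw [this]
    exact hWint.trans_lt (ENNReal.add_lt_top.2 ⟨hgB, ENNReal.ofReal_lt_top⟩)
  have hKm : MeasurableSet K := hK.isClosed.measurableSet
  -- Since `gstar ≤ W` on `K`, the excess over `Kᶜ` is at most the total excess `ε`. The subtraction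
  -- is legitimate because `gstar` has finite energy on `K`.
  have hcompl : ∫⁻ x in Kᶜ, W x ^ p ∂(μ.restrict B) ≤
      ∫⁻ x in Kᶜ, gstar x ^ p ∂(μ.restrict B) + ENNReal.ofReal ε := by
    have h1 := hWint
    rw [← lintegral_add_compl (fun x => W x ^ p) hKm,
      ← lintegral_add_compl (fun x => gstar x ^ p) hKm, add_assoc] at h1
    have h2 : ∫⁻ x in K, gstar x ^ p ∂(μ.restrict B) ≤ ∫⁻ x in K, W x ^ p ∂(μ.restrict B) :=
      lintegral_mono fun x => ENNReal.rpow_le_rpow (hgW x) hp0.le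
    have h3 : ∫⁻ x in K, gstar x ^ p ∂(μ.restrict B) ≠ ∞ :=
      ((setLIntegral_le_lintegral _ _).trans_lt hgB).ne
    exact (ENNReal.add_le_add_iff_left h3).1 ((add_le_add_left h2 _).trans h1)
  obtain ⟨gF, hgF⟩ := Newtonian.exists_isMinimalWeakUpperGradient hp0
    (hug.isWeakUpperGradient (μ := μ) hp0) hindfin
  refine ⟨F, iSup_le fun x => ?_, fun x hx => ?_, hF0, ⟨⟨?_, ?_⟩, B.indicator W, hug, hindfin⟩, hFc,
    gF, hgF, ?_⟩
  · exact (ENNReal.ofReal_le_iff_le_toReal hMtop).2 (hFM x)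
  · rw [hFf (Or.inl hx)]
    simp only
    rw [hu x hx, hreal x hx]
  · exact (measurable_coe_real_ereal.comp hFc.measurable).aemeasurable
  · calc ∫⁻ x, (F x : EReal).abs ^ p ∂μ ≤ ∫⁻ x, B.indicator (fun _ => ENNReal.ofReal M ^ p) x ∂μ := by
          refine lintegral_mono fun x => ?_
          rw [EReal.abs_def]
          by_cases hx : x ∈ B
          · rw [indicator_of_mem hx]
            exact ENNReal.rpow_le_rpow (ENNReal.ofReal_le_ofReal (hFM x)) hp0.le
          · rw [hF0 x hx]
            simp [hp0]
      _ = ENNReal.ofReal M ^ p * μ B := lintegral_indicator_const hB.measurableSet _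
      _ < ∞ := ENNReal.mul_lt_top
          (ENNReal.rpow_lt_top_of_nonneg hp0.le ENNReal.ofReal_ne_top) hμB
  · calc ∫⁻ x in Kᶜ, gF x ^ p ∂μ ≤ ∫⁻ x in Kᶜ, B.indicator W x ^ p ∂μ := by
          refine lintegral_mono_ae (ae_restrict_of_ae ?_)
          filter_upwards [hgF.2.2 _ (hug.isWeakUpperGradient hp0) hindfin] with x hx
          exact ENNReal.rpow_le_rpow hx hp0.le
      _ = ∫⁻ x in Kᶜ, W x ^ p ∂(μ.restrict B) := hind _ hKm.compl
      _ ≤ ∫⁻ x in Kᶜ, gstar x ^ p ∂(μ.restrict B) + ENNReal.ofReal ε := hcompl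
      _ ≤ ∫⁻ x in Kᶜ, gstar x ^ p ∂μ + ENNReal.ofReal ε := by
          gcongr
          exact Measure.restrict_le_self
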